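/- Let $k$ be a field of characteristic $p>0$, let $k[x_1,x_2]$ be the polynomial ring in two variables over $k$, and let $\mathrm{Aut}_k k[x_1,x_2]$ be the group, under composition, of its $k$-algebra automorphisms. Write $(f_1,f_2)$ for the $k$-algebra endomorphism of $k[x_1,x_2]$ with $x_1\mapsto f_1$ and $x_2\mapsto f_2$. Let $t\in k^*$ and $\epsilon:=(x_1+t,\,x_2)\in\mathrm{Aut}_k k[x_1,x_2]$, and let $$C(\epsilon):=\{\phi\in\mathrm{Aut}_k k[x_1,x_2]\mid \phi\epsilon=\epsilon\phi\}$$ be its centralizer. Let $H(t)$ be the subgroup of $\mathrm{Aut}_k k[x_1,x_2]$ generated by $$(x_1+g(x_2),\,x_2)\quad\text{and}\quad (x_1,\,x_2+g(x_1^p-t^{p-1}x_1))\quad\text{for all } g(x)\in xk[x],$$ and let $$H_0:=\{(x_1+u_1,\,ax_2+u_2)\mid a\in k^*,\ u_1,u_2\in k\}.$$ Then $C(\epsilon)=H(t)H_0$, where $H(t)H_0=\{\phi\psi\mid \phi\in H(t),\ \psi\in H_0\}$. -/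

import Mathlib

open scoped Pointwise

namespace PlaneAut

noncomputable section

/-- The group `Aut_k k[x₁, x₂]` of `k`-algebra automorphisms of `k[x₁, x₂]`, with composition
as multiplication; `x₁` is `X 0` and `x₂` is `X 1`. -/
abbrev Aut2 (k : Type*) [Field k] : Type _ :=
  MvPolynomial (Fin 2) k ≃ₐ[k] MvPolynomial (Fin 2) k

/-- The `k`-algebra endomorphism `(f₁, f₂)` of `k[x₁, x₂]`, with `x₁ ↦ f₁` and `x₂ ↦ f₂`. -/
def endo {k : Type*} [Field k] (f₁ f₂ : MvPolynomial (Fin 2) k) :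
    MvPolynomial (Fin 2) k →ₐ[k] MvPolynomial (Fin 2) k :=
  MvPolynomial.aeval ![f₁, f₂]

@[simp] theorem endo_X_zero {k : Type*} [Field k] (f₁ f₂ : MvPolynomial (Fin 2) k) :
    endo f₁ f₂ (MvPolynomial.X 0) = f₁ := by
  simp [endo]

@[simp] theorem endo_X_one {k : Type*} [Field k] (f₁ f₂ : MvPolynomial (Fin 2) k) :
    endo f₁ f₂ (MvPolynomial.X 1) = f₂ := by
  simp [endo]

@[simp] theorem endo_C {k : Type*} [Field k] (f₁ f₂ : MvPolynomial (Fin 2) k) (c : k) :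
    endo f₁ f₂ (MvPolynomial.C c) = MvPolynomial.C c := by
  simp [endo, MvPolynomial.algebraMap_eq]

theorem hom_ext {k : Type*} [Field k]
    {φ ψ : MvPolynomial (Fin 2) k →ₐ[k] MvPolynomial (Fin 2) k}
    (h0 : φ (MvPolynomial.X 0) = ψ (MvPolynomial.X 0))
    (h1 : φ (MvPolynomial.X 1) = ψ (MvPolynomial.X 1)) : φ = ψ := by
  apply MvPolynomial.algHom_ext
  intro i
  fin_cases i
  · exact h0
  · exact h1

/-- The automorphism `(x₁ + g(x₂), x₂)`, for `g ∈ k[x]`. -/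
def shearFst {k : Type*} [Field k] (g : Polynomial k) : Aut2 k :=
  AlgEquiv.ofAlgHom
    (endo (MvPolynomial.X 0 + Polynomial.aeval (MvPolynomial.X 1) g) (MvPolynomial.X 1))
    (endo (MvPolynomial.X 0 - Polynomial.aeval (MvPolynomial.X 1) g) (MvPolynomial.X 1))
    (hom_ext (by simp [← Polynomial.aeval_algHom_apply]) (by simp))
    (hom_ext (by simp [← Polynomial.aeval_algHom_apply]) (by simp))

/-- The automorphism `(x₁, x₂ + g(x₁))`, for `g ∈ k[x]`. -/
def shearSnd {k : Type*} [Field k] (g : Polynomial k) : Aut2 k :=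
  AlgEquiv.ofAlgHom
    (endo (MvPolynomial.X 0) (MvPolynomial.X 1 + Polynomial.aeval (MvPolynomial.X 0) g))
    (endo (MvPolynomial.X 0) (MvPolynomial.X 1 - Polynomial.aeval (MvPolynomial.X 0) g))
    (hom_ext (by simp) (by simp [← Polynomial.aeval_algHom_apply]))
    (hom_ext (by simp) (by simp [← Polynomial.aeval_algHom_apply]))

/-- The automorphism `(x₁ + u₁, a x₂ + u₂)`, for `a ∈ kˣ` and `u₁, u₂ ∈ k`. -/
def diagAff {k : Type*} [Field k] (a : kˣ) (u₁ u₂ : k) : Aut2 k :=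
  AlgEquiv.ofAlgHom
    (endo (MvPolynomial.X 0 + MvPolynomial.C u₁)
      (MvPolynomial.C (a : k) * MvPolynomial.X 1 + MvPolynomial.C u₂))
    (endo (MvPolynomial.X 0 - MvPolynomial.C u₁)
      (MvPolynomial.C ((a⁻¹ : kˣ) : k) * (MvPolynomial.X 1 - MvPolynomial.C u₂)))
    (hom_ext (by simp)
      (by simp [← mul_assoc, ← MvPolynomial.C_mul]))
    (hom_ext (by simp)
      (by simp [← mul_assoc, ← MvPolynomial.C_mul]))

/-- The translation `ε = (x₁ + t, x₂)`. -/
def translation {k : Type*} [Field k] (t : k) : Aut2 k :=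
  AlgEquiv.ofAlgHom
    (endo (MvPolynomial.X 0 + MvPolynomial.C t) (MvPolynomial.X 1))
    (endo (MvPolynomial.X 0 - MvPolynomial.C t) (MvPolynomial.X 1))
    (hom_ext (by simp) (by simp))
    (hom_ext (by simp) (by simp))

/-- The subgroup `H(t)` generated by `(x₁ + g(x₂), x₂)` and `(x₁, x₂ + g(x₁ᵖ - tᵖ⁻¹ x₁))` for all
`g ∈ x k[x]`. -/
def H {k : Type*} [Field k] (p : ℕ) (t : k) : Subgroup (Aut2 k) :=
  Subgroup.closure
    ({φ | ∃ g : Polynomial k, Polynomial.X ∣ g ∧ φ = shearFst g} ∪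
      {φ | ∃ g : Polynomial k, Polynomial.X ∣ g ∧
        φ = shearSnd (g.comp (Polynomial.X ^ p - Polynomial.C (t ^ (p - 1)) * Polynomial.X))})

/-- The set `H₀` of all `(x₁ + u₁, a x₂ + u₂)` with `a ∈ kˣ` and `u₁, u₂ ∈ k`. -/
def H₀ (k : Type*) [Field k] : Set (Aut2 k) :=
  {φ | ∃ (a : kˣ) (u₁ u₂ : k), φ = diagAff a u₁ u₂}

end

end PlaneAut

namespace PlaneAut

/-! The inclusion of H(t)H₀ in the centralizer is a check on generators: xᵖ - tᵖ⁻¹x is invariant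
under x ↦ x + t. For the converse let φ commute with ε. Then F = φ(x₂) is an ε-invariant coordinate,
and left multiplication of φ by a shear substitutes that shear into F. The proof lowers deg_{x₁} F +
deg_{x₂} F by shears from H(t) until F no longer involves x₁; then φ is a shear times an element of
H₀ (`mem_H_mul_of_degreeOf_zero_eq_zero`).

The descent rests on the shape of Newton polygons of coordinates. Conjugating by φ the translation
by s of the other coordinate gives a nontrivial deformation (P, Q) of the identity over k[x₁, x₂][s]
that fixes F (`exists_deformation`). With a suitable weight for s, its top part is still nontrivial
and fixes the top form of F (`exists_deformation_top`). Since k[x₁, x₂][s] is a domain, all factors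
of the deformed top form are constant in s, so an edge form is a power of a binomial x₁ᵃ - αx₂ᵇ with
a, b coprime; and P, Q would parametrize a generic cusp, which is impossible for a, b ≥ 2
(`eq_C_of_binomial_eq`). Hence a = 1 or b = 1 (`exists_binomial_top_form`).

If a = 1, the shear x₁ ↦ x₁ + αx₂ᵇ lies in H(t) and lowers the degree. If b = 1 and a ≥ 2, the shear
suggested by the top form need not commute with ε. Instead some x₂ ↦ x₂ + P(x₁) flattens the whole
polygon (`exists_shearSnd_mem_weightLE`). Invariance of F forces P(x + t) - P(x) to be a constant δ
(`natDegree_comp_X_add_C_sub_eq_zero`), so P - (δ/t)x is a polynomial in xᵖ - tᵖ⁻¹x. Up to its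
constant term this gives a shear in H(t), and the affine shear left over is too small to spoil the
reduction. -/

/-- The weight of the exponent `d` when `x₁`, `x₂` have weights `u`, `v`. -/
abbrev wt (u v : ℤ) (d : Fin 2 →₀ ℕ) : ℤ := u * d 0 + v * d 1

/-! ### Substitution in filtered and graded families of submodules -/

section Families

variable {k R : Type*} [Field k] [CommRing R] [Algebra k R]

theorem aeval_pair_eq_sum (P Q : R) (F : MvPolynomial (Fin 2) k) :
    MvPolynomial.aeval ![P, Q] F =
      ∑ d ∈ F.support, F.coeff d • (P ^ d 0 * Q ^ d 1) := by
  simp [MvPolynomial.aeval_def, MvPolynomial.eval₂_eq', Fin.prod_univ_two, Algebra.smul_def]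

theorem pow_mem_family {S : ℤ → Submodule k R} (one : 1 ∈ S 0)
    (mul : ∀ m n x y, x ∈ S m → y ∈ S n → x * y ∈ S (m + n)) {u : ℤ} {P : R} (hP : P ∈ S u)
    (n : ℕ) : P ^ n ∈ S (u * n) := by
  induction n with
  | zero => simpa using one
  | succ n ih =>
    have := mul _ _ _ _ ih hP
    rw [pow_succ]
    convert this using 2
    push_cast; ring

theorem aeval_mem_family {S : ℤ → Submodule k R} (one : 1 ∈ S 0)
    (mul : ∀ m n x y, x ∈ S m → y ∈ S n → x * y ∈ S (m + n)) {u v W : ℤ} {P Q : R}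
    (hP : P ∈ S u) (hQ : Q ∈ S v) {F : MvPolynomial (Fin 2) k}
    (hF : ∀ d ∈ F.support, S (wt u v d) ≤ S W) : MvPolynomial.aeval ![P, Q] F ∈ S W := by
  rw [aeval_pair_eq_sum]
  refine Submodule.sum_mem _ fun d hd => Submodule.smul_mem _ _ (hF d hd ?_)
  exact mul _ _ _ _ (pow_mem_family one mul hP _) (pow_mem_family one mul hQ _)

theorem pow_sub_pow_mem_family {S : ℤ → Submodule k R} (one : 1 ∈ S 0)
    (mul : ∀ m n x y, x ∈ S m → y ∈ S n → x * y ∈ S (m + n)) {u : ℤ} {P P' : R}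
    (hP : P ∈ S u) (hP' : P' ∈ S u) (h : P - P' ∈ S (u - 1)) (n : ℕ) :
    P ^ n - P' ^ n ∈ S (u * n - 1) := by
  induction n with
  | zero => simp
  | succ n ih =>
    have h1 := mul _ _ _ _ (pow_mem_family one mul hP n) h
    have h2 := mul _ _ _ _ ih hP'
    have e1 : u * n + (u - 1) = u * ((n + 1 : ℕ) : ℤ) - 1 := by push_cast; ring
    have e2 : u * n - 1 + u = u * ((n + 1 : ℕ) : ℤ) - 1 := by push_cast; ring
    rw [e1] at h1
    rw [e2] at h2
    convert Submodule.add_mem _ h1 h2 using 1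
    ring

/-- Changing P and Q by terms of lower weight does not affect the top weight of the result: monomial
by monomial, PⁱQʲ - P'ⁱQ'ʲ = Pⁱ(Qʲ - Q'ʲ) + (Pⁱ - P'ⁱ)Q'ʲ. -/
theorem aeval_sub_aeval_mem_family {S : ℤ → Submodule k R} (one : 1 ∈ S 0)
    (mul : ∀ m n x y, x ∈ S m → y ∈ S n → x * y ∈ S (m + n)) (mono : Monotone S)
    {u v W : ℤ} {P Q P' Q' : R} (hP : P ∈ S u) (hQ : Q ∈ S v) (hP' : P' ∈ S u) (hQ' : Q' ∈ S v)
    (hPP : P - P' ∈ S (u - 1)) (hQQ : Q - Q' ∈ S (v - 1)) {F : MvPolynomial (Fin 2) k}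
    (hF : ∀ d ∈ F.support, wt u v d ≤ W) :
    MvPolynomial.aeval ![P, Q] F - MvPolynomial.aeval ![P', Q'] F ∈ S (W - 1) := by
  rw [aeval_pair_eq_sum, aeval_pair_eq_sum, ← Finset.sum_sub_distrib]
  refine Submodule.sum_mem _ fun d hd => ?_
  rw [← smul_sub]
  refine Submodule.smul_mem _ _ (mono (sub_le_sub_right (hF d hd) 1) ?_)
  have h1 := mul _ _ _ _ (pow_mem_family one mul hP (d 0))
    (pow_sub_pow_mem_family one mul hQ hQ' hQQ (d 1))
  have h2 := mul _ _ _ _ (pow_sub_pow_mem_family one mul hP hP' hPP (d 0))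
    (pow_mem_family one mul hQ' (d 1))
  have e1 : u * (d 0 : ℤ) + (v * d 1 - 1) = wt u v d - 1 := by simp only [wt]; ring
  have e2 : u * (d 0 : ℤ) - 1 + v * d 1 = wt u v d - 1 := by simp only [wt]; ring
  rw [e1] at h1
  rw [e2] at h2
  convert Submodule.add_mem _ h1 h2 using 1
  ring

end Families

/-! ### Weights on k[x₁, x₂][s] and top parts -/

section Deformation

open Polynomial in
/-- The polynomials in `k[x₁, x₂][s]` all of whose monomials have a weight satisfying `p`, when
`x₁`, `x₂`, `s` have weights `u`, `v`, `-σ`. -/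
def suppIn (k : Type*) [Field k] (u v σ : ℤ) (p : ℤ → Prop) :
    Submodule k (MvPolynomial (Fin 2) k)[X] where
  carrier := {f | ∀ i d, (f.coeff i).coeff d ≠ 0 → p (wt u v d - σ * i)}
  zero_mem' := by simp
  add_mem' := by
    intro f g hf hg i d h
    by_cases h1 : (f.coeff i).coeff d = 0
    · by_cases h2 : (g.coeff i).coeff d = 0
      · simp [h1, h2] at h
      · exact hg i d h2
    · exact hf i d h1
  smul_mem' := by
    intro c f hf i d h
    refine hf i d fun h0 => h ?_
    simp [h0]

variable {k : Type*} [Field k] {u v σ : ℤ}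

open Polynomial

theorem suppIn_mono {p q : ℤ → Prop} (h : ∀ a, p a → q a) :
    suppIn k u v σ p ≤ suppIn k u v σ q := fun _ hf i d hd => h _ (hf i d hd)

theorem one_mem_suppIn {p : ℤ → Prop} (h : p 0) : 1 ∈ suppIn k u v σ p := by
  intro i d hd
  rw [Polynomial.coeff_one] at hd
  split_ifs at hd with hi
  · rw [MvPolynomial.coeff_one] at hd
    split_ifs at hd with hd'
    · subst hd'; subst hi; simpa [wt] using h
    · exact absurd rfl hd
  · simp at hd

theorem mul_mem_suppIn {p q r : ℤ → Prop} (h : ∀ a b, p a → q b → r (a + b))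
    {f g : (MvPolynomial (Fin 2) k)[X]} (hf : f ∈ suppIn k u v σ p) (hg : g ∈ suppIn k u v σ q) :
    f * g ∈ suppIn k u v σ r := by
  intro i d hd
  rw [Polynomial.coeff_mul, MvPolynomial.coeff_sum] at hd
  obtain ⟨⟨i₁, i₂⟩, hi, h1⟩ := Finset.exists_ne_zero_of_sum_ne_zero hd
  rw [MvPolynomial.coeff_mul] at h1
  obtain ⟨⟨d₁, d₂⟩, hd', h2⟩ := Finset.exists_ne_zero_of_sum_ne_zero h1
  rw [Finset.HasAntidiagonal.mem_antidiagonal] at hi hd'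
  subst hi; subst hd'
  have := h _ _ (hf _ _ (left_ne_zero_of_mul h2)) (hg _ _ (right_ne_zero_of_mul h2))
  convert this using 1
  simp only [wt, Finsupp.add_apply]; push_cast; ring

theorem C_mem_suppIn {p : ℤ → Prop} {f : MvPolynomial (Fin 2) k}
    (h : ∀ d ∈ f.support, p (wt u v d)) : C f ∈ suppIn k u v σ p := by
  intro i d hd
  rw [Polynomial.coeff_C] at hd
  split_ifs at hd with hi
  · subst hi; simpa using h d (MvPolynomial.mem_support_iff.2 hd)
  · simp at hd

theorem eq_zero_of_mem_suppIn {p q : ℤ → Prop} (h : ∀ a, p a → ¬ q a)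
    {f : (MvPolynomial (Fin 2) k)[X]} (hf : f ∈ suppIn k u v σ p) (hg : f ∈ suppIn k u v σ q) :
    f = 0 := by
  ext i d
  by_contra hne
  exact h _ (hf i d (by simpa using hne)) (hg i d (by simpa using hne))

variable (u v σ) in
/-- The part of weight `W` of a polynomial in `k[x₁, x₂][s]`. -/
noncomputable def weightPart (W : ℤ) (f : (MvPolynomial (Fin 2) k)[X]) :
    (MvPolynomial (Fin 2) k)[X] :=
  ∑ i ∈ f.support, monomial i (∑ d ∈ (f.coeff i).support,
    if wt u v d - σ * i = W then MvPolynomial.monomial d ((f.coeff i).coeff d) else 0)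

theorem coeff_weightPart (W : ℤ) (f : (MvPolynomial (Fin 2) k)[X]) (i : ℕ) (d : Fin 2 →₀ ℕ) :
    ((weightPart u v σ W f).coeff i).coeff d =
      if wt u v d - σ * i = W then (f.coeff i).coeff d else 0 := by
  classical
  simp only [weightPart, Polynomial.finsetSum_coeff, Polynomial.coeff_monomial,
    Finset.sum_ite_eq', Polynomial.mem_support_iff]
  by_cases hi : f.coeff i = 0
  · simp [hi]
  · rw [if_pos hi, MvPolynomial.coeff_sum]
    have : ∀ e ∈ (f.coeff i).support, MvPolynomial.coeff d
        (if wt u v e - σ * i = W then MvPolynomial.monomial e ((f.coeff i).coeff e) else 0) =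
        if e = d then (if wt u v d - σ * i = W then (f.coeff i).coeff d else 0) else 0 := by
      intro e _
      split_ifs with h1 h2 h3 h4 h5 <;> simp_all [MvPolynomial.coeff_monomial]
    rw [Finset.sum_congr rfl this, Finset.sum_ite_eq']
    by_cases hd : d ∈ (f.coeff i).support
    · rw [if_pos hd]
    · rw [if_neg hd, MvPolynomial.notMem_support_iff.1 hd]; simp

theorem weightPart_mem (W : ℤ) (f : (MvPolynomial (Fin 2) k)[X]) :
    weightPart u v σ W f ∈ suppIn k u v σ (· = W) := by
  intro i d hd
  rw [coeff_weightPart] at hd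
  by_contra h
  simp [h] at hd

theorem sub_weightPart_mem {W : ℤ} {f : (MvPolynomial (Fin 2) k)[X]}
    (hf : f ∈ suppIn k u v σ (· ≤ W)) : f - weightPart u v σ W f ∈ suppIn k u v σ (· ≤ W - 1) := by
  intro i d hd
  rw [Polynomial.coeff_sub, MvPolynomial.coeff_sub, coeff_weightPart] at hd
  split_ifs at hd with h
  · simp at hd
  · have := hf i d (by simpa using hd)
    omega

/-- If the deformation `(P, Q)` of the identity fixes `F`, then its top part fixes the top form
of `F`. -/
theorem aeval_weightPart_eq {P Q : (MvPolynomial (Fin 2) k)[X]}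
    (hP : P ∈ suppIn k u v σ (· ≤ u)) (hQ : Q ∈ suppIn k u v σ (· ≤ v))
    {F F₀ : MvPolynomial (Fin 2) k} {W : ℤ} (hF : MvPolynomial.aeval ![P, Q] F = C F)
    (h₀ : ∀ d ∈ F₀.support, wt u v d = W) (h₁ : ∀ d ∈ (F - F₀).support, wt u v d ≤ W - 1) :
    MvPolynomial.aeval ![weightPart u v σ u P, weightPart u v σ v Q] F₀ = C F₀ := by
  set P' := weightPart u v σ u P
  set Q' := weightPart u v σ v Q
  have mul1 : ∀ (m n : ℤ) (x y : (MvPolynomial (Fin 2) k)[X]), x ∈ suppIn k u v σ (· ≤ m) →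
      y ∈ suppIn k u v σ (· ≤ n) → x * y ∈ suppIn k u v σ (· ≤ m + n) :=
    fun m n x y => mul_mem_suppIn fun a b h1 h2 => by omega
  have mul2 : ∀ (m n : ℤ) (x y : (MvPolynomial (Fin 2) k)[X]), x ∈ suppIn k u v σ (· = m) →
      y ∈ suppIn k u v σ (· = n) → x * y ∈ suppIn k u v σ (· = m + n) :=
    fun m n x y => mul_mem_suppIn fun a b h1 h2 => by omega
  have one1 : (1 : (MvPolynomial (Fin 2) k)[X]) ∈ suppIn k u v σ (· ≤ 0) := one_mem_suppIn le_rfl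
  have one2 : (1 : (MvPolynomial (Fin 2) k)[X]) ∈ suppIn k u v σ (· = 0) := one_mem_suppIn rfl
  have mono : Monotone fun m : ℤ => suppIn k u v σ (· ≤ m) :=
    fun m n h => suppIn_mono fun a ha => ha.trans h
  have hP' : P' ∈ suppIn k u v σ (· = u) := weightPart_mem _ _
  have hQ' : Q' ∈ suppIn k u v σ (· = v) := weightPart_mem _ _
  have hPle : P' ∈ suppIn k u v σ (· ≤ u) := suppIn_mono (fun a h => h.le) hP'
  have hQle : Q' ∈ suppIn k u v σ (· ≤ v) := suppIn_mono (fun a h => h.le) hQ'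
  have e1 : MvPolynomial.aeval ![P', Q'] F₀ ∈ suppIn k u v σ (· = W) :=
    aeval_mem_family (S := fun m => suppIn k u v σ (· = m)) one2 mul2 hP' hQ'
      fun d hd => by rw [h₀ d hd]
  have e2 : C F₀ ∈ suppIn k u v σ (· = W) := C_mem_suppIn h₀
  have e3 : MvPolynomial.aeval ![P, Q] F₀ - MvPolynomial.aeval ![P', Q'] F₀ ∈
      suppIn k u v σ (· ≤ W - 1) :=
    aeval_sub_aeval_mem_family (S := fun m => suppIn k u v σ (· ≤ m)) one1 mul1 mono hP hQ hPle
      hQle (sub_weightPart_mem hP) (sub_weightPart_mem hQ) fun d hd => (h₀ d hd).le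
  have e4 : MvPolynomial.aeval ![P, Q] (F - F₀) ∈ suppIn k u v σ (· ≤ W - 1) :=
    aeval_mem_family (S := fun m => suppIn k u v σ (· ≤ m)) one1 mul1 hP hQ
      fun d hd => mono (h₁ d hd)
  have e5 : C (F - F₀) ∈ suppIn k u v σ (· ≤ W - 1) := C_mem_suppIn h₁
  -- The difference is homogeneous of weight W and also has weight at most W - 1, so it vanishes.
  refine sub_eq_zero.1 (eq_zero_of_mem_suppIn (p := (· = W)) (q := (· ≤ W - 1))
    (fun a h => by omega) (Submodule.sub_mem _ e1 e2) ?_)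
  have : MvPolynomial.aeval ![P', Q'] F₀ - C F₀ =
      C (F - F₀) - MvPolynomial.aeval ![P, Q] (F - F₀) -
        (MvPolynomial.aeval ![P, Q] F₀ - MvPolynomial.aeval ![P', Q'] F₀) := by
    rw [map_sub (MvPolynomial.aeval (R := k) ![P, Q]), hF, C_sub]; ring
  rw [this]
  exact Submodule.sub_mem _ (Submodule.sub_mem _ e5 e4) e3

end Deformation

/-! ### Deformations of the identity fixing a coordinate -/

section Deformation

variable {k : Type*} [Field k]

open Polynomial

/-- For each coordinate `φ(xᵢ)`, the translations of the other coordinate give a nontrivial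
deformation of the identity which fixes `φ(xᵢ)`. -/
theorem exists_deformation (φ : Aut2 k) (i : Fin 2) :
    ∃ f : Fin 2 → (MvPolynomial (Fin 2) k)[X], (∀ j, (f j).coeff 0 = MvPolynomial.X j) ∧
      (∃ j, f j ≠ C (MvPolynomial.X j)) ∧
      MvPolynomial.aeval f (φ (MvPolynomial.X i)) = C (φ (MvPolynomial.X i)) := by
  -- `T` keeps xᵢ and translates the other variable by s; `E` is its conjugate φTφ⁻¹, which fixes
  -- φ(xᵢ) and is the identity at s = 0.
  let T : MvPolynomial (Fin 2) k →ₐ[k] (MvPolynomial (Fin 2) k)[X] :=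
    MvPolynomial.aeval fun j => if j = i then C (MvPolynomial.X j) else C (MvPolynomial.X j) + X
  let E : MvPolynomial (Fin 2) k →ₐ[k] (MvPolynomial (Fin 2) k)[X] :=
    (Polynomial.mapAlgHom (φ : MvPolynomial (Fin 2) k →ₐ[k] MvPolynomial (Fin 2) k)).comp
      (T.comp (φ.symm : MvPolynomial (Fin 2) k →ₐ[k] MvPolynomial (Fin 2) k))
  have hE : ∀ j, E (φ (MvPolynomial.X j)) = if j = i then C (φ (MvPolynomial.X j)) else
      C (φ (MvPolynomial.X j)) + X := by
    intro j
    simp only [E, T, AlgHom.comp_apply, AlgEquiv.coe_toAlgHom, AlgEquiv.symm_apply_apply,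
      MvPolynomial.aeval_X]
    split_ifs <;> simp
  have hEf : MvPolynomial.aeval (fun j => E (MvPolynomial.X j)) = E :=
    MvPolynomial.algHom_ext fun j => by simp
  refine ⟨fun j => E (MvPolynomial.X j), ?_, ?_, ?_⟩
  · let ev : (MvPolynomial (Fin 2) k)[X] →ₐ[k] MvPolynomial (Fin 2) k :=
      (Polynomial.aeval (0 : MvPolynomial (Fin 2) k)).restrictScalars k
    have hev : ∀ g, ev g = g.coeff 0 := fun g => by
      simp [ev, Polynomial.coeff_zero_eq_aeval_zero]
    have h1 : (ev.comp E).comp (φ : MvPolynomial (Fin 2) k →ₐ[k] MvPolynomial (Fin 2) k) = φ := by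
      refine MvPolynomial.algHom_ext fun j => ?_
      simp only [AlgHom.comp_apply, AlgEquiv.coe_toAlgHom, hE, hev]
      split_ifs <;> simp
    intro j
    have h2 := DFunLike.congr_fun h1 (φ.symm (MvPolynomial.X j))
    simpa [hev] using h2
  · by_contra! h
    have h1 : E = (Algebra.ofId _ _ : MvPolynomial (Fin 2) k →ₐ[MvPolynomial (Fin 2) k]
        (MvPolynomial (Fin 2) k)[X]).restrictScalars k :=
      MvPolynomial.algHom_ext fun j => by simpa [Algebra.ofId_apply] using h j
    have h2 : ∀ g, E g = C g := fun g => by simp [h1, Algebra.ofId_apply]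
    have h3 := hE (i + 1)
    have h4 : i + 1 ≠ i := by simp
    rw [h2, if_neg h4] at h3
    have := congrArg (Polynomial.coeff · 1) h3
    simp at this
  · rw [hEf, hE, if_pos rfl]

/-- The top form of a coordinate, for any weights, is fixed by a nontrivial deformation of the
identity. -/
theorem exists_deformation_top (φ : Aut2 k) (i : Fin 2) {u v W : ℤ} {F₀ : MvPolynomial (Fin 2) k}
    (h₀ : ∀ d ∈ F₀.support, wt u v d = W)
    (h₁ : ∀ d ∈ (φ (MvPolynomial.X i) - F₀).support, wt u v d ≤ W - 1) :
    ∃ P Q : (MvPolynomial (Fin 2) k)[X], P.coeff 0 = MvPolynomial.X 0 ∧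
      Q.coeff 0 = MvPolynomial.X 1 ∧ ¬ (P = C (MvPolynomial.X 0) ∧ Q = C (MvPolynomial.X 1)) ∧
      MvPolynomial.aeval ![P, Q] F₀ = C F₀ := by
  classical
  obtain ⟨f, hf0, ⟨j', hj'⟩, hf⟩ := exists_deformation φ i
  let ω : Fin 2 → ℤ := ![u, v]
  -- The monomials xᵈsⁱ of `f j` with i > 0, that is, those by which the deformation differs from
  -- the identity.
  let S : Finset (Fin 2 × ℕ × (Fin 2 →₀ ℕ)) := Finset.univ.biUnion fun j =>
    ((f j).support.erase 0).biUnion fun i => ((f j).coeff i).support.image fun d => (j, i, d)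
  have hS : ∀ j i d, (j, i, d) ∈ S ↔ i ≠ 0 ∧ ((f j).coeff i).coeff d ≠ 0 := by
    intro j i d
    simp only [S, Finset.mem_biUnion, Finset.mem_univ, true_and, Finset.mem_image,
      Finset.mem_erase, Polynomial.mem_support_iff, MvPolynomial.mem_support_iff, Prod.mk.injEq]
    constructor
    · rintro ⟨j, i, ⟨h1, h2⟩, d, h3, rfl, rfl, rfl⟩
      exact ⟨h1, h3⟩
    · rintro ⟨h1, h2⟩
      exact ⟨j, i, ⟨h1, fun h => h2 (by simp [h])⟩, d, h2, rfl, rfl, rfl⟩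
  have hne : S.Nonempty := by
    by_contra hS'
    rw [Finset.not_nonempty_iff_eq_empty] at hS'
    refine hj' (Polynomial.ext fun i => MvPolynomial.ext _ _ fun d => ?_)
    rcases eq_or_ne i 0 with rfl | hi
    · simp [hf0]
    · rw [Polynomial.coeff_C, if_neg hi, MvPolynomial.coeff_zero]
      by_contra h
      have := (hS j' i d).2 ⟨hi, h⟩
      simp [hS'] at this
  -- The largest slope σ/n is the smallest value for minus the weight of s such that no monomial of
  -- `f j` exceeds the weight of xⱼ. The maximizing monomial attains this weight, so it survives in
  -- the top part and keeps the deformation nontrivial. All weights are multiplied by n to stay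
  -- integral.
  obtain ⟨⟨j₀, n, d₀⟩, hmem, hmax⟩ :=
    Finset.exists_max_image S (fun x => ((wt u v x.2.2 - ω x.1 : ℤ) : ℚ) / (x.2.1 : ℚ)) hne
  obtain ⟨hn, hc⟩ := (hS _ _ _).1 hmem
  have hnpos : 0 < (n : ℤ) := by omega
  set σ : ℤ := wt u v d₀ - ω j₀ with hσ
  have hwt : ∀ d, wt (n * u) (n * v) d = n * wt u v d := fun d => by simp only [wt]; ring
  have hX : ∀ j d, (MvPolynomial.X j : MvPolynomial (Fin 2) k).coeff d ≠ 0 →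
      wt u v d = ω j := by
    intro j d hd
    rw [MvPolynomial.coeff_X] at hd
    split_ifs at hd with h
    · subst h; fin_cases j <;> simp [wt, ω]
    · exact absurd rfl hd
  have hle : ∀ j, f j ∈ suppIn k (n * u) (n * v) σ (· ≤ n * ω j) := by
    intro j i d hd
    rcases eq_or_ne i 0 with rfl | hi
    · rw [hf0] at hd
      simp [hwt, hX j d hd]
    · have h := hmax _ ((hS _ _ _).2 ⟨hi, hd⟩)
      have hi' : (0 : ℚ) < i := by exact_mod_cast Nat.pos_of_ne_zero hi
      have hn' : (0 : ℚ) < n := by exact_mod_cast hnpos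
      simp only at h
      rw [div_le_div_iff₀ hi' hn'] at h
      have h' : (wt u v d - ω j) * n ≤ σ * i := by exact_mod_cast h
      simp only [hwt]
      linarith
  have hpart0 : ∀ j, (weightPart (n * u) (n * v) σ (n * ω j) (f j)).coeff 0 =
      MvPolynomial.X j := by
    intro j
    ext d
    rw [coeff_weightPart, hf0]
    split_ifs with h
    · rfl
    · by_contra h'
      exact h (by simp [hwt, hX j d (Ne.symm h')])
  have hf' : MvPolynomial.aeval ![f 0, f 1] (φ (MvPolynomial.X i)) = C (φ (MvPolynomial.X i)) := by
    rw [← hf]; congr 2; funext j; fin_cases j <;> rfl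
  refine ⟨weightPart (n * u) (n * v) σ (n * u) (f 0), weightPart (n * u) (n * v) σ (n * v) (f 1),
    hpart0 0, hpart0 1, ?_, aeval_weightPart_eq (W := n * W) (hle 0) (hle 1) hf' ?_ ?_⟩
  · rintro ⟨h1, h2⟩
    have h3 : weightPart (n * u) (n * v) σ (n * ω j₀) (f j₀) = C (MvPolynomial.X j₀) := by
      fin_cases j₀
      · exact h1
      · exact h2
    have h4 := congrArg (fun g => MvPolynomial.coeff d₀ (Polynomial.coeff g n)) h3
    simp only [coeff_weightPart, Polynomial.coeff_C, if_neg hn, MvPolynomial.coeff_zero] at h4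
    rw [if_pos (by rw [hwt, hσ]; ring)] at h4
    exact hc h4
  · intro d hd
    rw [hwt, h₀ d hd]
  · intro d hd
    rw [hwt]
    nlinarith [h₁ d hd]

end Deformation

/-! ### Rigidity of generic cuspidal curves -/

section Cusp

variable {k : Type*} [Field k]

open Polynomial

theorem C_C_ne_zero {β : k} (hβ : β ≠ 0) :
    (C (MvPolynomial.C β) : (MvPolynomial (Fin 2) k)[X]) ≠ 0 := by
  simpa using hβ

theorem eq_C_of_natDegree_eq_zero_left {a b : ℕ} (hb : b ≠ 0) {β γ : k}
    (hγ : γ ≠ 0) {i j : Fin 2} {P Q : (MvPolynomial (Fin 2) k)[X]}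
    (hP0 : P.coeff 0 = MvPolynomial.X i) (hQ0 : Q.coeff 0 = MvPolynomial.X j)
    {r : MvPolynomial (Fin 2) k}
    (h : C (MvPolynomial.C β) * P ^ a + C (MvPolynomial.C γ) * Q ^ b = C r)
    (hP : P.natDegree = 0) : P = C (MvPolynomial.X i) ∧ Q = C (MvPolynomial.X j) := by
  have h1 : P = C (MvPolynomial.X i) := by rw [← hP0]; exact eq_C_of_natDegree_eq_zero hP
  refine ⟨h1, ?_⟩
  have h2 : C (MvPolynomial.C γ) * Q ^ b = C (r - MvPolynomial.C β * MvPolynomial.X i ^ a) := by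
    rw [C_sub, ← h, h1]; simp
  have h3 := congrArg natDegree h2
  rw [natDegree_C, natDegree_C_mul (by simpa using hγ), natDegree_pow] at h3
  rw [← hQ0]
  exact eq_C_of_natDegree_eq_zero ((Nat.mul_eq_zero.1 h3).resolve_left hb)

/-- Differentiate the coefficients with respect to xᵢ. As p divides b, the term in Q disappears and
aβPᵃ⁻¹∂P = aβxᵢᵃ⁻¹, which is nonzero and free of s. Since a ≥ 2, P divides it, so P is constant in
s. -/
theorem eq_C_of_char_dvd (p : ℕ) [CharP k p] {a b : ℕ} (ha : 2 ≤ a) (hb : b ≠ 0)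
    (hpa : ¬ p ∣ a) (hpb : p ∣ b) {β γ : k} (hβ : β ≠ 0) (hγ : γ ≠ 0) {i j : Fin 2} (hij : i ≠ j)
    {P Q : (MvPolynomial (Fin 2) k)[X]}
    (hP0 : P.coeff 0 = MvPolynomial.X i) (hQ0 : Q.coeff 0 = MvPolynomial.X j)
    (h : C (MvPolynomial.C β) * P ^ a + C (MvPolynomial.C γ) * Q ^ b =
      C (MvPolynomial.C β * MvPolynomial.X i ^ a + MvPolynomial.C γ * MvPolynomial.X j ^ b)) :
    P = C (MvPolynomial.X i) ∧ Q = C (MvPolynomial.X j) := by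
  refine eq_C_of_natDegree_eq_zero_left hb hγ hP0 hQ0 h ?_
  let _ : Differential (MvPolynomial (Fin 2) k) :=
    ⟨(MvPolynomial.pderiv (R := k) i).restrictScalars ℤ⟩
  let D : Derivation ℤ (MvPolynomial (Fin 2) k)[X] (MvPolynomial (Fin 2) k)[X] :=
    Differential.mapCoeffs
  have hbk : (b : k) = 0 := (CharP.cast_eq_zero_iff k p b).2 hpb
  have hak : (a : k) ≠ 0 := fun h0 => hpa ((CharP.cast_eq_zero_iff k p a).1 h0)
  have hDC : ∀ g, D (C g) = C (MvPolynomial.pderiv i g) := fun g =>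
    Differential.mapCoeffs_C g
  have hbA : (b : (MvPolynomial (Fin 2) k)[X]) = 0 := by
    have : (b : (MvPolynomial (Fin 2) k)[X]) = C (MvPolynomial.C (b : k)) := by simp
    rw [this, hbk]; simp
  have h1 := congrArg D h
  rw [hDC] at h1
  simp only [map_add, Derivation.leibniz, Derivation.leibniz_pow, hDC,
    MvPolynomial.pderiv_C, MvPolynomial.pderiv_X_self, MvPolynomial.pderiv_X_of_ne hij.symm,
    smul_eq_mul, nsmul_eq_mul, hbA, map_zero, mul_zero, zero_mul, add_zero, mul_one,
    C_mul] at h1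
  have h2 : P ∣ C (MvPolynomial.C β) * (C (a : MvPolynomial (Fin 2) k) *
      C (MvPolynomial.X i ^ (a - 1))) := by
    rw [← h1]
    exact Dvd.dvd.mul_left (Dvd.dvd.mul_left (Dvd.dvd.mul_right (dvd_pow_self _ (by omega)) _) _) _
  rw [← C_mul, ← C_mul] at h2
  have h3 := natDegree_le_of_dvd h2 ?_
  · rwa [natDegree_C, Nat.le_zero] at h3
  · rw [Ne, C_eq_zero]
    have : (a : MvPolynomial (Fin 2) k) = MvPolynomial.C (a : k) := by simp
    rw [this]
    exact mul_ne_zero (MvPolynomial.C_ne_zero.2 hβ) (mul_ne_zero (MvPolynomial.C_ne_zero.2 hak)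
      (pow_ne_zero _ (MvPolynomial.X_ne_zero _)))

theorem binomial_ne_zero {a b : ℕ} (ha : a ≠ 0) {β γ : k} (hβ : β ≠ 0)
    {i j : Fin 2} (hij : i ≠ j) :
    (MvPolynomial.C β * MvPolynomial.X i ^ a + MvPolynomial.C γ * MvPolynomial.X j ^ b :
      MvPolynomial (Fin 2) k) ≠ 0 := by
  intro h
  have h1 := congrArg (MvPolynomial.coeff (Finsupp.single i a)) h
  rw [MvPolynomial.coeff_add, MvPolynomial.coeff_C_mul, MvPolynomial.coeff_C_mul,
    MvPolynomial.coeff_X_pow, MvPolynomial.coeff_X_pow, if_pos rfl, if_neg] at h1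
  · simp [hβ] at h1
  · intro h2
    have := DFunLike.congr_fun h2 i
    simp [hij, ha.symm] at this

/-- The generic curve `β x₁ᵃ + γ x₂ᵇ = r` with `a, b ≥ 2` coprime has no nontrivial polynomial
deformations. -/
theorem eq_C_of_binomial_eq (p : ℕ) [Fact p.Prime] [CharP k p] {a b : ℕ} (ha : 2 ≤ a) (hb : 2 ≤ b)
    (hab : a.Coprime b) {β γ : k} (hβ : β ≠ 0) (hγ : γ ≠ 0) {i j : Fin 2} (hij : i ≠ j)
    {P Q : (MvPolynomial (Fin 2) k)[X]}
    (hP0 : P.coeff 0 = MvPolynomial.X i) (hQ0 : Q.coeff 0 = MvPolynomial.X j)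
    (h : C (MvPolynomial.C β) * P ^ a + C (MvPolynomial.C γ) * Q ^ b =
      C (MvPolynomial.C β * MvPolynomial.X i ^ a + MvPolynomial.C γ * MvPolynomial.X j ^ b)) :
    P = C (MvPolynomial.X i) ∧ Q = C (MvPolynomial.X j) := by
  have hp : p.Prime := Fact.out
  by_cases hpa : p ∣ a
  · have hpb : ¬ p ∣ b := fun hpb => by
      have := Nat.dvd_gcd hpa hpb
      rw [hab] at this
      exact hp.one_lt.ne' (Nat.dvd_one.1 this)
    exact (eq_C_of_char_dvd p hb (by omega) hpb hpa hγ hβ hij.symm hQ0 hP0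
      (by rw [add_comm, h, add_comm])).symm
  by_cases hpb : p ∣ b
  · exact eq_C_of_char_dvd p ha (by omega) hpa hpb hβ hγ hij hP0 hQ0 h
  have hak : (a : k) ≠ 0 := fun h0 => hpa ((CharP.cast_eq_zero_iff k p a).1 h0)
  have hbk : (b : k) ≠ 0 := fun h0 => hpb ((CharP.cast_eq_zero_iff k p b).1 h0)
  have hcast : ∀ n : ℕ, (n : (MvPolynomial (Fin 2) k)[X]) = C (MvPolynomial.C (n : k)) :=
    fun n => by simp
  have haB : (a : (MvPolynomial (Fin 2) k)[X]) ≠ 0 := by rw [hcast]; exact C_C_ne_zero hak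
  have hbB : (b : (MvPolynomial (Fin 2) k)[X]) ≠ 0 := by rw [hcast]; exact C_C_ne_zero hbk
  have hβB : (C (MvPolynomial.C β) : (MvPolynomial (Fin 2) k)[X]) ≠ 0 := C_C_ne_zero hβ
  have hγB : (C (MvPolynomial.C γ) : (MvPolynomial (Fin 2) k)[X]) ≠ 0 := C_C_ne_zero hγ
  -- The induction on the degree in s treats inseparable P and Q, for which the derivatives in s
  -- carry no information.
  induction hN : P.natDegree using Nat.strong_induction_on generalizing P Q with
  | _ N ih =>
  subst hN
  by_cases hdeg : P.natDegree = 0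
  · exact eq_C_of_natDegree_eq_zero_left (by omega) hγ hP0 hQ0 h hdeg
  have hP : P ≠ 0 := fun h0 => hdeg (by simp [h0])
  have hQdeg : Q.natDegree ≠ 0 := fun h0 => hdeg (by
    rw [(eq_C_of_natDegree_eq_zero_left (b := a) (by omega) hβ hQ0 hP0
      (by rw [add_comm, h]) h0).2, natDegree_C])
  have hQ : Q ≠ 0 := fun h0 => hQdeg (by simp [h0])
  have hd : C (MvPolynomial.C β) * ((a : (MvPolynomial (Fin 2) k)[X]) * P ^ (a - 1) * derivative P) +
      C (MvPolynomial.C γ) * ((b : (MvPolynomial (Fin 2) k)[X]) * Q ^ (b - 1) * derivative Q) = 0 := by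
    have := congrArg derivative h
    simpa [derivative_pow] using this
  have hu := binomial_ne_zero (a := a) (b := b) (γ := γ) (by omega) hβ hij
  set u := (MvPolynomial.C β * MvPolynomial.X i ^ a + MvPolynomial.C γ * MvPolynomial.X j ^ b :
      MvPolynomial (Fin 2) k)
  by_cases hP' : derivative P = 0
  -- Both derivatives vanish, so P and Q are polynomials in sᵖ, and replacing sᵖ by s lowers the
  -- degree.
  · have hQ' : derivative Q = 0 := by
      rw [hP'] at hd
      simpa [hγB, hbB, hQ] using hd
    have e1 := expand_contract p hP' hp.ne_zero
    have e2 := expand_contract p hQ' hp.ne_zero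
    have hlt : (contract p P).natDegree < P.natDegree := by
      rw [← e1, natDegree_expand, contract_expand _ hp.ne_zero]
      rw [← e1, natDegree_expand] at hdeg
      have := hp.two_le
      have : 0 < (contract p P).natDegree := Nat.pos_of_ne_zero fun h0 => hdeg (by simp [h0])
      nlinarith
    obtain ⟨h1, h2⟩ := ih _ hlt (P := contract p P) (Q := contract p Q)
      (by simpa [coeff_contract hp.ne_zero] using hP0)
      (by simpa [coeff_contract hp.ne_zero] using hQ0) (by
        apply expand_injective hp.pos
        rw [expand_C, ← h]
        simp only [map_add, map_mul, map_pow, expand_C]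
        rw [e1, e2]) rfl
    rw [h1, expand_C] at e1
    rw [h2, expand_C] at e2
    exact ⟨e1.symm, e2.symm⟩
  · have hQ' : derivative Q ≠ 0 := by
      intro h0
      rw [h0] at hd
      simp [hβB, haB, hP, hP'] at hd
    exfalso
    have ea : P ^ a = P ^ (a - 1) * P := by rw [← pow_succ]; congr 1; omega
    have eb : Q ^ b = Q ^ (b - 1) * Q := by rw [← pow_succ]; congr 1; omega
    -- Eliminating between the equation and its derivative gives Pᵃ⁻¹ ∣ buQ' and Qᵇ⁻¹ ∣ auP'. Then
    -- deg P ≤ deg Q' < deg Q ≤ deg P' < deg P, which is absurd.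
    have h1 : P ^ (a - 1) ∣ C (u * (b : MvPolynomial (Fin 2) k)) * derivative Q := by
      refine ⟨C (MvPolynomial.C β) * ((b : (MvPolynomial (Fin 2) k)[X]) * P * derivative Q - (a : (MvPolynomial (Fin 2) k)[X]) * Q * derivative P), ?_⟩
      rw [C_mul, ← h, ea, eb, map_natCast]
      linear_combination Q * hd
    have h2 : Q ^ (b - 1) ∣ C (u * (a : MvPolynomial (Fin 2) k)) * derivative P := by
      refine ⟨C (MvPolynomial.C γ) * ((a : (MvPolynomial (Fin 2) k)[X]) * Q * derivative P - (b : (MvPolynomial (Fin 2) k)[X]) * P * derivative Q), ?_⟩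
      rw [C_mul, ← h, ea, eb, map_natCast]
      linear_combination P * hd
    have hbA : (b : MvPolynomial (Fin 2) k) ≠ 0 := fun h0 => hbB (by simp [← C_eq_natCast, h0])
    have haA : (a : MvPolynomial (Fin 2) k) ≠ 0 := fun h0 => haB (by simp [← C_eq_natCast, h0])
    have hub : u * (b : MvPolynomial (Fin 2) k) ≠ 0 := mul_ne_zero hu hbA
    have hua : u * (a : MvPolynomial (Fin 2) k) ≠ 0 := mul_ne_zero hu haA
    have d1 := natDegree_le_of_dvd h1 (mul_ne_zero (C_ne_zero.2 hub) hQ')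
    have d2 := natDegree_le_of_dvd h2 (mul_ne_zero (C_ne_zero.2 hua) hP')
    rw [natDegree_C_mul hub, natDegree_pow] at d1
    rw [natDegree_C_mul hua, natDegree_pow] at d2
    have l1 := natDegree_derivative_lt hQdeg
    have l2 := natDegree_derivative_lt hdeg
    have : P.natDegree ≤ (a - 1) * P.natDegree := Nat.le_mul_of_pos_left _ (by omega)
    have : Q.natDegree ≤ (b - 1) * Q.natDegree := Nat.le_mul_of_pos_left _ (by omega)
    omega

end Cusp

/-! ### Quasi-homogeneous forms fixed by a deformation -/

section Binomial

open Polynomial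

theorem homogenize_prod_X_sub_C {K : Type*} [Field K] (c : K) (S : Multiset K) :
    (C c * (S.map fun α => X - C α).prod).homogenize (Multiset.card S) =
      MvPolynomial.C c *
        (S.map fun α => MvPolynomial.X 0 - MvPolynomial.C α * MvPolynomial.X 1).prod := by
  rw [homogenize_C_mul]
  congr 1
  induction S using Multiset.induction_on with
  | empty => simp
  | cons α S ih =>
    rw [Multiset.map_cons, Multiset.prod_cons, Multiset.map_cons, Multiset.prod_cons,
      Multiset.card_cons, add_comm, homogenize_mul _ _ (natDegree_X_sub_C_le α)
        (natDegree_multiset_prod_X_sub_C_eq_card S).le, ih]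
    simp [homogenize_sub]

theorem natDegree_eq_zero_of_dvd_C {R : Type*} [CommRing R] [IsDomain R] {f : R[X]} {r : R}
    (hr : r ≠ 0) (h : f ∣ C r) : f.natDegree = 0 := by
  have := natDegree_le_of_dvd h (by simpa using hr)
  simpa using this

/-- Over the algebraically closed field K the left side is a constant times Pᵐ times factors Pᵃ -
αQᵇ. Their product is nonzero and free of s, hence so is each factor. Nontriviality makes both P and
Q depend on s, so m = 0; and two distinct roots would make Qᵇ free of s, so there is one root. -/
theorem exists_root_of_deformation_aux {k : Type*} [Field k] (K : Type*) [Field K]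
    [IsAlgClosed K] [Algebra k K] {P Q : (MvPolynomial (Fin 2) k)[X]}
    (hP0 : P.coeff 0 = MvPolynomial.X 0) (hQ0 : Q.coeff 0 = MvPolynomial.X 1)
    (hne : ¬ (P = C (MvPolynomial.X 0) ∧ Q = C (MvPolynomial.X 1))) {a b m : ℕ} (ha : a ≠ 0)
    (hb : b ≠ 0) {h : k[X]} (hL : h.natDegree ≠ 0) (h0 : h.coeff 0 ≠ 0)
    {r : MvPolynomial (Fin 2) k} (hr : r ≠ 0)
    (heq : P ^ m * MvPolynomial.aeval ![P ^ a, Q ^ b] (h.homogenize h.natDegree) = C r) :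
    m = 0 ∧ ∃ α : k, α ≠ 0 ∧ h = C h.leadingCoeff * (X - C α) ^ h.natDegree ∧
      C (MvPolynomial.C 1) * P ^ a + C (MvPolynomial.C (-α)) * Q ^ b =
        C (MvPolynomial.C 1 * MvPolynomial.X 0 ^ a +
          MvPolynomial.C (-α) * MvPolynomial.X 1 ^ b) := by
  let ι : k →+* K := algebraMap k K
  let ιA : MvPolynomial (Fin 2) k →+* MvPolynomial (Fin 2) K := MvPolynomial.map ι
  have hιA : Function.Injective ιA := MvPolynomial.map_injective _ ι.injective
  have hιB : Function.Injective (Polynomial.map ιA) := Polynomial.map_injective _ hιA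
  have hP0' : (P.map ιA).coeff 0 = MvPolynomial.X 0 := by simp [hP0, ιA]
  have hQ0' : (Q.map ιA).coeff 0 = MvPolynomial.X 1 := by simp [hQ0, ιA]
  have hne' : ¬ (P.map ιA = C (MvPolynomial.X 0) ∧ Q.map ιA = C (MvPolynomial.X 1)) := by
    rintro ⟨h1, h2⟩
    exact hne ⟨hιB (by simpa [ιA] using h1), hιB (by simpa [ιA] using h2)⟩
  set P' := P.map ιA
  set Q' := Q.map ιA
  set S := (h.map ι).roots
  have hprod : h.map ι = C (ι h.leadingCoeff) * (S.map fun α => X - C α).prod := by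
    have := (IsAlgClosed.splits (h.map ι)).eq_prod_roots
    rwa [leadingCoeff_map] at this
  have hcard : Multiset.card S = h.natDegree := by
    have := (IsAlgClosed.splits (h.map ι)).natDegree_eq_card_roots
    rw [natDegree_map] at this
    exact this.symm
  have hroot0 : ∀ α ∈ S, α ≠ 0 := by
    rintro α hα rfl
    have h1 := (mem_roots'.1 hα).2
    rw [IsRoot.def, ← coeff_zero_eq_eval_zero, coeff_map] at h1
    exact h0 (ι.injective (by simpa using h1))
  have heq' : P' ^ m * (C (MvPolynomial.C (ι h.leadingCoeff)) *
      (S.map fun α => P' ^ a - C (MvPolynomial.C α) * Q' ^ b).prod) = C (ιA r) := by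
    have h1 := congrArg (Polynomial.mapRingHom ιA) heq
    rw [map_mul, map_pow, MvPolynomial.map_aeval] at h1
    simp only [coe_mapRingHom, map_C] at h1
    rw [← h1]
    refine congrArg (P' ^ m * ·) ?_
    have h2 : ((mapRingHom ιA).comp (algebraMap k (MvPolynomial (Fin 2) k)[X])) =
        (algebraMap K (MvPolynomial (Fin 2) K)[X]).comp ι := by
      ext x
      simp [ιA, Polynomial.algebraMap_apply, MvPolynomial.algebraMap_eq]
    rw [h2, MvPolynomial.coe_eval₂Hom, ← MvPolynomial.eval₂_map, ← homogenize_map, hprod, ← hcard,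
      homogenize_prod_X_sub_C, MvPolynomial.eval₂_mul, MvPolynomial.eval₂_C,
      ← MvPolynomial.coe_eval₂Hom, map_multiset_prod, Multiset.map_map]
    simp [Polynomial.algebraMap_apply, MvPolynomial.algebraMap_eq, P', Q']
  have hr' : ιA r ≠ 0 := (map_ne_zero_iff _ hιA).2 hr
  have hdvd : ∀ α ∈ S, (P' ^ a - C (MvPolynomial.C α) * Q' ^ b).natDegree = 0 := fun α hα =>
    natDegree_eq_zero_of_dvd_C hr' <| heq' ▸ Dvd.dvd.mul_left (Dvd.dvd.mul_left
      (Multiset.dvd_prod (Multiset.mem_map_of_mem _ hα)) _) _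
  have hconst : ∀ α ∈ S, C (MvPolynomial.C 1) * P' ^ a + C (MvPolynomial.C (-α)) * Q' ^ b =
      C (MvPolynomial.X 0 ^ a - MvPolynomial.C α * MvPolynomial.X 1 ^ b) := by
    intro α hα
    have h1 := eq_C_of_natDegree_eq_zero (hdvd α hα)
    rw [coeff_sub, coeff_C_mul, coeff_zero_eq_eval_zero, coeff_zero_eq_eval_zero (Q' ^ b),
      eval_pow, eval_pow, ← coeff_zero_eq_eval_zero, ← coeff_zero_eq_eval_zero, hP0', hQ0'] at h1
    rw [← h1]; simp; ring
  obtain ⟨α, hα⟩ : ∃ α, α ∈ S := Multiset.card_pos_iff_exists_mem.1 (by omega)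
  have hPdeg : P'.natDegree ≠ 0 := fun h1 =>
    hne' (eq_C_of_natDegree_eq_zero_left hb (neg_ne_zero.2 (hroot0 α hα)) hP0' hQ0' (hconst α hα) h1)
  have hQdeg : Q'.natDegree ≠ 0 := fun h1 =>
    hne' (eq_C_of_natDegree_eq_zero_left ha one_ne_zero hQ0' hP0'
      (by rw [add_comm]; exact hconst α hα) h1).symm
  have hm : m = 0 := by
    by_contra hm
    exact hPdeg (natDegree_eq_zero_of_dvd_C hr' <| heq' ▸ Dvd.dvd.mul_right (dvd_pow_self _ hm) _)
  have hS : S = Multiset.replicate h.natDegree α := by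
    refine Multiset.eq_replicate.2 ⟨hcard, fun β hβ => ?_⟩
    by_contra hβα
    have h1 : C (MvPolynomial.C (β - α)) * Q' ^ b =
        C ((MvPolynomial.X 0 ^ a - MvPolynomial.C α * MvPolynomial.X 1 ^ b) -
          (MvPolynomial.X 0 ^ a - MvPolynomial.C β * MvPolynomial.X 1 ^ b)) := by
      rw [C_sub, ← hconst α hα, ← hconst β hβ]
      simp only [map_neg, map_sub]; ring
    have h2 := congrArg natDegree h1
    rw [natDegree_C, natDegree_C_mul (MvPolynomial.C_ne_zero.2 (sub_ne_zero.2 hβα)), natDegree_pow] at h2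
    exact hQdeg ((Nat.mul_eq_zero.1 h2).resolve_left hb)
  -- The root lies in k even when it might be inseparable: in the leading power of s of Qᵇ, the
  -- relation Pᵃ - αQᵇ = const exhibits α as a quotient of two coefficients in k.
  obtain ⟨α', rfl⟩ : ∃ α' : k, ι α' = α := by
    have hQb : (Q ^ b).natDegree ≠ 0 := by
      rw [natDegree_pow]
      refine mul_ne_zero hb fun h1 => hQdeg ?_
      rw [natDegree_map_eq_of_injective hιA, h1]
    have hlc : (Q ^ b).leadingCoeff ≠ 0 := leadingCoeff_ne_zero.2 fun h1 => hQb (by simp [h1])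
    obtain ⟨d, hd⟩ := MvPolynomial.exists_coeff_ne_zero hlc
    have h1 := congrArg (fun f => MvPolynomial.coeff d (f.coeff (Q ^ b).natDegree)) (hconst α hα)
    simp only [P', Q', ← Polynomial.map_pow, coeff_add, coeff_C_mul, coeff_map, coeff_C, if_neg hQb,
      MvPolynomial.coeff_add, MvPolynomial.coeff_C_mul, MvPolynomial.coeff_zero, ιA,
      MvPolynomial.coeff_map] at h1
    refine ⟨((P ^ a).coeff (Q ^ b).natDegree).coeff d / ((Q ^ b).leadingCoeff).coeff d, ?_⟩
    have h2 : ι (((Q ^ b).leadingCoeff).coeff d) ≠ 0 := (map_ne_zero ι).2 hd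
    rw [map_div₀, div_eq_iff h2]
    rw [leadingCoeff]
    linear_combination h1
  refine ⟨hm, α', fun h1 => hroot0 _ hα (by simp [h1]), ?_, ?_⟩
  · apply Polynomial.map_injective ι ι.injective
    conv_lhs => rw [hprod, hS]
    simp
  · apply hιB
    have := hconst _ hα
    simp only [Polynomial.map_add, Polynomial.map_mul, Polynomial.map_pow, map_C]
    simp only [ιA, map_add, map_mul, map_pow, MvPolynomial.map_C, MvPolynomial.map_X, map_neg,
      map_one] at this ⊢
    rw [this]
    simp only [map_sub, map_mul, map_pow]
    ring

/-- If a quasi-homogeneous form with at least two monomials, one of which is a power of `x₁`, is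
fixed by a nontrivial deformation of the identity, then it is a power of a binomial. -/
theorem exists_root_of_deformation {k : Type*} [Field k]
    {P Q : (MvPolynomial (Fin 2) k)[X]}
    (hP0 : P.coeff 0 = MvPolynomial.X 0) (hQ0 : Q.coeff 0 = MvPolynomial.X 1)
    (hne : ¬ (P = C (MvPolynomial.X 0) ∧ Q = C (MvPolynomial.X 1))) {a b m : ℕ} (ha : a ≠ 0)
    (hb : b ≠ 0) {h : k[X]} (hL : h.natDegree ≠ 0) (h0 : h.coeff 0 ≠ 0)
    {r : MvPolynomial (Fin 2) k} (hr : r ≠ 0)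
    (heq : P ^ m * MvPolynomial.aeval ![P ^ a, Q ^ b] (h.homogenize h.natDegree) = C r) :
    m = 0 ∧ ∃ α : k, α ≠ 0 ∧ h = C h.leadingCoeff * (X - C α) ^ h.natDegree ∧
      C (MvPolynomial.C 1) * P ^ a + C (MvPolynomial.C (-α)) * Q ^ b =
        C (MvPolynomial.C 1 * MvPolynomial.X 0 ^ a +
          MvPolynomial.C (-α) * MvPolynomial.X 1 ^ b) :=
  exists_root_of_deformation_aux (AlgebraicClosure k) hP0 hQ0 hne ha hb hL h0 hr heq

end Binomial

/-! ### Newton polygons of coordinates -/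

section Edge

variable {k : Type*} [Field k]

open MvPolynomial

theorem exists_mem_support_degreeOf {F : MvPolynomial (Fin 2) k} {i : Fin 2}
    (h : degreeOf i F ≠ 0) : ∃ d ∈ F.support, d i = degreeOf i F := by
  have hne : F.support.Nonempty := by
    rw [Finset.nonempty_iff_ne_empty, Ne, support_eq_empty]
    rintro rfl
    simp at h
  obtain ⟨d, hd, he⟩ := Finset.exists_mem_eq_sup F.support hne fun m => m i
  exact ⟨d, hd, by rw [degreeOf_eq_sup, he]⟩

theorem eq_single_add_single (d : Fin 2 →₀ ℕ) :
    d = Finsupp.single 0 (d 0) + Finsupp.single 1 (d 1) := by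
  ext i; fin_cases i <;> simp

theorem finsupp_ext {d e : Fin 2 →₀ ℕ} (h0 : d 0 = e 0) (h1 : d 1 = e 1) : d = e := by
  ext i; fin_cases i
  · exact h0
  · exact h1

theorem eq_C_of_pow_mul_pow {P Q : Polynomial (MvPolynomial (Fin 2) k)} {c : k}
    {i j : ℕ} {r : MvPolynomial (Fin 2) k} (hr : r ≠ 0)
    (h : Polynomial.C (C c) * (P ^ i * Q ^ j) = Polynomial.C r) (hi : i ≠ 0) :
    P = Polynomial.C (P.coeff 0) := by
  refine Polynomial.eq_C_of_natDegree_eq_zero (natDegree_eq_zero_of_dvd_C hr ?_)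
  rw [← h]
  exact Dvd.dvd.mul_left (Dvd.dvd.mul_right (dvd_pow_self _ hi) _) _

/-- The monomials of a coordinate of maximal degree in `x₁` do not involve `x₂`. -/
theorem eq_zero_of_eq_degreeOf_zero (φ : Aut2 k) (i : Fin 2)
    (h0 : degreeOf 0 (φ (X i)) ≠ 0) {d : Fin 2 →₀ ℕ} (hd : d ∈ (φ (X i)).support)
    (hd0 : d 0 = degreeOf 0 (φ (X i))) : d 1 = 0 := by
  classical
  set F := φ (X i)
  -- As M exceeds every exponent of x₂, the weights (M, 1) order the monomials of F
  -- lexicographically, and the top form is a single monomial.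
  set M := degreeOf 1 F + 1
  have hM : ∀ e ∈ F.support, e 1 < M := fun e he =>
    Nat.lt_succ_of_le (monomial_le_degreeOf 1 he)
  obtain ⟨e, he, hmax⟩ := Finset.exists_max_image F.support (fun e => M * e 0 + e 1) ⟨d, hd⟩
  have he0 : d 0 ≤ e 0 := by
    by_contra hlt
    have h1 := hmax d hd
    have h2 := hM e he
    have h3 : M * (e 0 + 1) ≤ M * d 0 := Nat.mul_le_mul_left _ (by omega)
    rw [mul_add] at h3
    omega
  have hc : F.coeff e ≠ 0 := mem_support_iff.1 he
  obtain ⟨P, Q, hP, hQ, hne, heq⟩ := exists_deformation_top φ i (u := M) (v := 1)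
    (W := wt M 1 e) (F₀ := monomial e (F.coeff e))
    (fun d' hd' => by
      rw [support_monomial, if_neg hc, Finset.mem_singleton] at hd'
      rw [hd'])
    (fun d' hd' => by
      rw [mem_support_iff, coeff_sub, coeff_monomial] at hd'
      split_ifs at hd' with hed
      · subst hed; simp [F] at hd'
      · rw [sub_zero] at hd'
        have hd's := mem_support_iff.2 hd'
        have h1 := hmax d' hd's
        have h2 : M * d' 0 + d' 1 ≠ M * e 0 + e 1 := by
          intro h2
          have h3 := hM d' hd's
          have h4 := hM e he
          have h5 : d' 0 = e 0 := by
            rcases lt_trichotomy (d' 0) (e 0) with h | h | h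
            · have : M * (d' 0 + 1) ≤ M * e 0 := Nat.mul_le_mul_left _ (by omega)
              rw [mul_add] at this; omega
            · exact h
            · have : M * (e 0 + 1) ≤ M * d' 0 := Nat.mul_le_mul_left _ (by omega)
              rw [mul_add] at this; omega
          exact hed (finsupp_ext h5.symm (by rw [h5] at h2; omega))
        have h4 : M * d' 0 + d' 1 + 1 ≤ M * e 0 + e 1 := by omega
        simp only [wt]
        zify at h4
        linarith)
  have h1 : Polynomial.C (C (F.coeff e)) * (P ^ e 0 * Q ^ e 1) =
      Polynomial.C (monomial e (F.coeff e)) := by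
    rw [← heq, aeval_monomial, Finsupp.prod_fintype _ _ (by simp), Fin.prod_univ_two]
    simp [Polynomial.algebraMap_apply, algebraMap_eq]
  have hr : monomial e (F.coeff e) ≠ 0 := by rwa [Ne, monomial_eq_zero]
  -- The exponent of x₁ is positive. If that of x₂ were too, both P and Q would divide a nonzero
  -- polynomial free of s, and the deformation would be trivial.
  have e1 : e 1 = 0 := by
    by_contra h2
    refine hne ⟨?_, ?_⟩
    · rw [← hP]; exact eq_C_of_pow_mul_pow hr h1 (by omega)
    · rw [← hQ]; exact eq_C_of_pow_mul_pow hr (by rw [mul_comm (Q ^ _), h1]) h2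
  have h2 := hmax d hd
  have h3 : M * e 0 ≤ M * d 0 := Nat.mul_le_mul_left _ (hd0 ▸ monomial_le_degreeOf 0 he)
  simp only [e1] at h2
  omega

/-- A coordinate involving both variables has, for suitable weights, a power of a binomial
`x₁ᵃ - α x₂ᵇ` with `a = 1` or `b = 1` as its top form. -/
theorem exists_binomial_top_form (p : ℕ) [Fact p.Prime] [CharP k p] (φ : Aut2 k) (i : Fin 2)
    (h0 : degreeOf 0 (φ (X i)) ≠ 0) (h1 : degreeOf 1 (φ (X i)) ≠ 0) :
    ∃ a b L : ℕ, a ≠ 0 ∧ b ≠ 0 ∧ L ≠ 0 ∧ (a = 1 ∨ b = 1) ∧ ∃ c α : k, c ≠ 0 ∧ α ≠ 0 ∧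
      ∀ d ∈ (φ (X i) - C c * (X 0 ^ a - C α * X 1 ^ b) ^ L).support,
        b * d 0 + a * d 1 < a * b * L := by
  classical
  have hvert := fun d => eq_zero_of_eq_degreeOf_zero φ i h0 (d := d)
  have hdeform := fun u v W F₀ => exists_deformation_top φ i (u := u) (v := v) (W := W) (F₀ := F₀)
  set F := φ (X i)
  set N := degreeOf 0 F
  have hN : ∀ d ∈ F.support, d 0 ≤ N := fun d hd => monomial_le_degreeOf 0 hd
  obtain ⟨dN, hdN, hdN0⟩ := exists_mem_support_degreeOf h0
  have hdN1 := hvert dN hdN hdN0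
  obtain ⟨d₁, hd₁, hd₁'⟩ := exists_mem_support_degreeOf h1
  -- The edge of the Newton polygon leaving the vertex (N, 0) goes through `e`. In lowest terms its
  -- direction is (-a, b), so it lies on the line b·d₀ + a·d₁ = b·N.
  obtain ⟨e, he, hmin⟩ := Finset.exists_min_image (F.support.filter fun d => d 1 ≠ 0)
    (fun d => ((N - d 0 : ℕ) : ℚ) / (d 1 : ℚ))
    ⟨d₁, Finset.mem_filter.2 ⟨hd₁, by omega⟩⟩
  obtain ⟨heF, he1⟩ := Finset.mem_filter.1 he
  have heN : e 0 < N := lt_of_le_of_ne (hN e heF) fun h => he1 (hvert e heF h)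
  obtain ⟨g, a, b, hgpos, hab, ha', hb'⟩ :=
    Nat.exists_coprime' (m := N - e 0) (n := e 1) (Nat.gcd_pos_of_pos_right _ (by omega))
  have ha : a ≠ 0 := by rintro rfl; omega
  have hb : b ≠ 0 := by rintro rfl; omega
  have hle : ∀ d ∈ F.support, b * d 0 + a * d 1 ≤ b * N := by
    intro d hd
    have hdN' := hN d hd
    rcases eq_or_ne (d 1) 0 with hd1 | hd1
    · rw [hd1, mul_zero, add_zero]; exact Nat.mul_le_mul_left _ hdN'
    · have h := hmin d (Finset.mem_filter.2 ⟨hd, hd1⟩)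
      have p1 : (0 : ℚ) < e 1 := by exact_mod_cast Nat.pos_of_ne_zero he1
      have p2 : (0 : ℚ) < d 1 := by exact_mod_cast Nat.pos_of_ne_zero hd1
      rw [div_le_div_iff₀ p1 p2] at h
      have h' : (N - e 0) * d 1 ≤ (N - d 0) * e 1 := by exact_mod_cast h
      rw [ha', hb'] at h'
      have h'' : a * d 1 ≤ b * (N - d 0) := by
        refine le_of_mul_le_mul_left (a := g) ?_ hgpos
        calc g * (a * d 1) = a * g * d 1 := by ring
          _ ≤ _ := h'
          _ = _ := by ring
      calc b * d 0 + a * d 1 ≤ b * d 0 + b * (N - d 0) := by omega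
        _ = b * N := by rw [← mul_add]; congr 1; omega
  have heq : ∀ d : Fin 2 →₀ ℕ, b * d 0 + a * d 1 = b * N →
      ∃ l, a * l ≤ N ∧ d = Finsupp.single 0 (N - a * l) + Finsupp.single 1 (b * l) := by
    intro d hd
    have hdvd : b ∣ a * d 1 := (Nat.dvd_add_right (Dvd.intro _ rfl)).1 (hd ▸ Dvd.intro _ rfl)
    obtain ⟨l, hl⟩ := hab.symm.dvd_of_dvd_mul_left hdvd
    have h2 : d 0 + a * l = N := by
      refine Nat.eq_of_mul_eq_mul_left (Nat.pos_of_ne_zero hb) ?_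
      rw [← hd, hl]; ring
    exact ⟨l, by omega, finsupp_ext (by simp; omega) (by simp [hl])⟩
  -- The lattice points of the edge that occur in F, at l steps from (N, 0); the largest such l is
  -- `L`, the other end of the edge.
  let I := (Finset.range (N + 1)).filter fun l => a * l ≤ N ∧
    F.coeff (Finsupp.single 0 (N - a * l) + Finsupp.single 1 (b * l)) ≠ 0
  have hI : ∀ l, l ∈ I ↔ a * l ≤ N ∧
      F.coeff (Finsupp.single 0 (N - a * l) + Finsupp.single 1 (b * l)) ≠ 0 := by
    intro l
    simp only [I, Finset.mem_filter, Finset.mem_range, and_iff_right_iff_imp]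
    rintro ⟨h, -⟩
    exact Nat.lt_succ_of_le ((Nat.le_mul_of_pos_left l (Nat.pos_of_ne_zero ha)).trans h)
  have hgI : g ∈ I := by
    have : a * g ≤ N := by omega
    refine (hI g).2 ⟨this, ?_⟩
    rw [← hb', ← ha', show N - (N - e 0) = e 0 by omega, ← eq_single_add_single]
    exact mem_support_iff.1 heF
  obtain ⟨L, hLI, hLmax⟩ := I.exists_max_image id ⟨g, hgI⟩
  simp only [id] at hLmax
  have hLg := hLmax g hgI
  have hL : L ≠ 0 := by omega
  obtain ⟨hLN, hLc⟩ := (hI L).1 hLI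
  set m := N - a * L with hm
  let ex : ℕ → Fin 2 →₀ ℕ := fun j => Finsupp.single 0 (m + a * j) + Finsupp.single 1 (b * (L - j))
  have hex0 : ∀ j, ex j 0 = m + a * j := fun j => by simp [ex]
  have hex1 : ∀ j, ex j 1 = b * (L - j) := fun j => by simp [ex]
  have hexinj : ∀ j j', ex j = ex j' → j = j' := by
    intro j j' h
    have := DFunLike.congr_fun h 0
    rw [hex0, hex0] at this
    exact Nat.eq_of_mul_eq_mul_left (Nat.pos_of_ne_zero ha) (by omega)
  -- The edge form is x₁ᵐ times the homogenization of `h` in (x₁ᵃ, x₂ᵇ). The coefficients of `h` in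
  -- degrees 0 and L are those of the two ends of the edge, hence nonzero.
  let h : Polynomial k := ∑ j ∈ Finset.range (L + 1), Polynomial.monomial j (F.coeff (ex j))
  have hcoeff : ∀ j, h.coeff j = if j ≤ L then F.coeff (ex j) else 0 := by
    intro j
    simp only [h, Polynomial.finsetSum_coeff, Polynomial.coeff_monomial, Finset.sum_ite_eq',
      Finset.mem_range, Nat.lt_succ_iff]
  have hexL : F.coeff (ex L) ≠ 0 := by
    have : ex L = dN := finsupp_ext (by rw [hex0, hdN0]; omega) (by rw [hex1, hdN1]; simp)
    rw [this]; exact mem_support_iff.1 hdN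
  have hhdeg : h.natDegree = L := by
    refine Polynomial.natDegree_eq_of_le_of_coeff_ne_zero ?_ (by rw [hcoeff, if_pos le_rfl]; exact hexL)
    exact Polynomial.natDegree_le_iff_coeff_eq_zero.2 fun j hj => by
      rw [hcoeff, if_neg (by omega)]
  have hh0 : h.coeff 0 ≠ 0 := by
    rw [hcoeff, if_pos (Nat.zero_le _)]
    have : ex 0 = Finsupp.single 0 (N - a * L) + Finsupp.single 1 (b * L) := by simp [ex, hm]
    rwa [this]
  let F₀ : MvPolynomial (Fin 2) k :=
    ∑ j ∈ Finset.range (L + 1), monomial (ex j) (F.coeff (ex j))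
  have haeval : ∀ {R : Type _} [CommRing R] [Algebra k R] (U V : R),
      aeval ![U, V] F₀ = U ^ m * aeval ![U ^ a, V ^ b] (h.homogenize h.natDegree) := by
    intro R _ _ U V
    rw [hhdeg]
    simp only [F₀, h, Polynomial.homogenize_finsetSum, map_sum, Finset.mul_sum]
    refine Finset.sum_congr rfl fun j hj => ?_
    rw [Polynomial.homogenize_monomial (Nat.lt_succ_iff.1 (Finset.mem_range.1 hj)), aeval_monomial,
      aeval_monomial, Finsupp.prod_fintype _ _ (by simp), Finsupp.prod_fintype _ _ (by simp),
      Fin.prod_univ_two, Fin.prod_univ_two, hex0, hex1]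
    simp [pow_add, pow_mul]
    ring
  have hcF₀ : ∀ d, F₀.coeff d = if ∃ j ≤ L, d = ex j then F.coeff d else 0 := by
    intro d
    simp only [F₀, coeff_sum, coeff_monomial]
    split_ifs with hd
    · obtain ⟨j, hj, rfl⟩ := hd
      rw [Finset.sum_eq_single j]
      · simp
      · intro j' _ hj'
        rw [if_neg fun h => hj' (hexinj _ _ h)]
      · intro hj'; simp at hj'; omega
    · refine Finset.sum_eq_zero fun j hj => if_neg ?_
      rintro rfl
      exact hd ⟨j, Nat.lt_succ_iff.1 (Finset.mem_range.1 hj), rfl⟩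
  have hlt : ∀ d ∈ (F - F₀).support, b * d 0 + a * d 1 < b * N := by
    intro d hd
    rw [mem_support_iff, coeff_sub, hcF₀] at hd
    split_ifs at hd with hj
    · simp at hd
    · rw [sub_zero] at hd
      refine lt_of_le_of_ne (hle d (mem_support_iff.2 hd)) fun h2 => hj ?_
      obtain ⟨l, hl, rfl⟩ := heq d h2
      have h3 := hLmax l ((hI l).2 ⟨hl, hd⟩)
      refine ⟨L - l, by omega, finsupp_ext ?_ ?_⟩
      · rw [hex0, Nat.mul_sub]
        have := Nat.mul_le_mul_left a h3
        simp; omega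
      · rw [hex1, show L - (L - l) = l by omega]; simp
  have hwtex : ∀ j ≤ L, b * (ex j) 0 + a * (ex j) 1 = b * N := by
    intro j hj
    obtain ⟨j', rfl⟩ := Nat.exists_eq_add_of_le hj
    rw [hex0, hex1, show N = m + a * (j + j') by omega, show j + j' - j = j' by omega]
    ring
  obtain ⟨P, Q, hP, hQ, hne, hPQ⟩ := hdeform b a ((b * N : ℕ) : ℤ) F₀
    (fun d hd => by
      rw [mem_support_iff, hcF₀] at hd
      split_ifs at hd with hj
      · obtain ⟨j, hj, rfl⟩ := hj
        rw [← hwtex j hj]; push_cast; rfl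
      · simp at hd)
    (fun d hd => by
      have := hlt d hd
      zify at this
      simp only [wt]
      push_cast
      linarith)
  have hF₀ne : F₀ ≠ 0 := by
    intro h2
    have h3 := hcF₀ (ex L)
    rw [h2, if_pos ⟨L, le_rfl, rfl⟩] at h3
    exact hexL (by rw [← h3]; simp)
  rw [haeval] at hPQ
  obtain ⟨hm0, α, hα, hhα, hbin⟩ := exists_root_of_deformation hP hQ hne ha hb
    (by rw [hhdeg]; exact hL) hh0 hF₀ne hPQ
  refine ⟨a, b, L, ha, hb, hL, ?_, h.leadingCoeff, α, ?_, hα, ?_⟩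
  · by_contra! hab1
    exact hne (eq_C_of_binomial_eq p (by omega) (by omega) hab one_ne_zero (neg_ne_zero.2 hα)
      (by decide) hP hQ hbin)
  · rw [Polynomial.leadingCoeff, hcoeff, hhdeg, if_pos le_rfl]; exact hexL
  · have hF₀ : F₀ = C h.leadingCoeff * (X 0 ^ a - C α * X 1 ^ b) ^ L := by
      have h2 := haeval (R := MvPolynomial (Fin 2) k) (X 0) (X 1)
      have h3 : (![X 0, X 1] : Fin 2 → MvPolynomial (Fin 2) k) = X := by
        funext j; fin_cases j <;> rfl
      have h4 := homogenize_prod_X_sub_C h.leadingCoeff (Multiset.replicate L α)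
      rw [Multiset.map_replicate, Multiset.prod_replicate, Multiset.card_replicate,
        Multiset.map_replicate, Multiset.prod_replicate, ← hhdeg, ← hhα, hhdeg] at h4
      rw [h3, aeval_X_left_apply, hm0, pow_zero, one_mul, hhdeg, h4] at h2
      rw [h2]
      simp [algebraMap_eq]
    rw [← hF₀]
    intro d hd
    have := hlt d hd
    rw [show N = a * L by omega] at this
    linarith [show b * (a * L) = a * b * L by ring]

end Edge

/-! ### Weighted degree on k[x₁, x₂] -/

section WeightLE

open MvPolynomial

/-- The polynomials of weighted degree at most `W`, where `x₁` and `x₂` have weights `u`, `v`. -/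
def weightLE (k : Type*) [Field k] (u v W : ℤ) : Submodule k (MvPolynomial (Fin 2) k) where
  carrier := {f | ∀ d ∈ f.support, wt u v d ≤ W}
  zero_mem' := by simp
  add_mem' := by
    classical
    intro f g hf hg d hd
    rcases Finset.mem_union.1 (support_add hd) with h | h
    · exact hf d h
    · exact hg d h
  smul_mem' := fun c f hf d hd => hf d (support_smul hd)

variable {k : Type*} [Field k] {u v : ℤ}

theorem mem_weightLE {W : ℤ} {f : MvPolynomial (Fin 2) k} :
    f ∈ weightLE k u v W ↔ ∀ d ∈ f.support, wt u v d ≤ W := Iff.rfl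

theorem weightLE_mono : Monotone (weightLE k u v) := fun _ _ h _ hf d hd => (hf d hd).trans h

theorem C_mem_weightLE (c : k) : C c ∈ weightLE k u v 0 := by
  classical
  intro d hd
  rw [mem_support_iff, coeff_C] at hd
  split_ifs at hd with h
  · subst h; simp [wt]
  · exact absurd rfl hd

theorem one_mem_weightLE : 1 ∈ weightLE k u v 0 := C_mem_weightLE 1

theorem mul_mem_weightLE {m n : ℤ} {f g : MvPolynomial (Fin 2) k} (hf : f ∈ weightLE k u v m)
    (hg : g ∈ weightLE k u v n) : f * g ∈ weightLE k u v (m + n) := by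
  classical
  intro d hd
  obtain ⟨d₁, h₁, d₂, h₂, rfl⟩ := Finset.mem_add.1 (support_mul f g hd)
  have := add_le_add (hf _ h₁) (hg _ h₂)
  refine le_trans (le_of_eq ?_) this
  simp only [wt, Finsupp.add_apply]; push_cast; ring

theorem pow_mem_weightLE {m : ℤ} {f : MvPolynomial (Fin 2) k} (hf : f ∈ weightLE k u v m) (n : ℕ) :
    f ^ n ∈ weightLE k u v (m * n) :=
  pow_mem_family (S := weightLE k u v) one_mem_weightLE (fun _ _ _ _ => mul_mem_weightLE) hf n

theorem C_mul_mem_weightLE {m : ℤ} {f : MvPolynomial (Fin 2) k} (c : k)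
    (hf : f ∈ weightLE k u v m) : C c * f ∈ weightLE k u v m := by
  rw [C_mul']; exact Submodule.smul_mem _ _ hf

theorem X_zero_mem_weightLE : (X 0 : MvPolynomial (Fin 2) k) ∈ weightLE k u v u := by
  intro d hd
  rw [support_X, Finset.mem_singleton] at hd
  simp [hd, wt]

theorem X_one_mem_weightLE : (X 1 : MvPolynomial (Fin 2) k) ∈ weightLE k u v v := by
  intro d hd
  rw [support_X, Finset.mem_singleton] at hd
  simp [hd, wt]

theorem aeval_mem_weightLE {u' v' W : ℤ} {P Q F : MvPolynomial (Fin 2) k}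
    (hP : P ∈ weightLE k u v u') (hQ : Q ∈ weightLE k u v v') (hF : F ∈ weightLE k u' v' W) :
    aeval ![P, Q] F ∈ weightLE k u v W :=
  aeval_mem_family (S := weightLE k u v) one_mem_weightLE (fun _ _ _ _ => mul_mem_weightLE) hP hQ
    fun d hd => weightLE_mono (hF d hd)

theorem degreeOf_zero_le {n : ℕ} {f : MvPolynomial (Fin 2) k} :
    degreeOf 0 f ≤ n ↔ f ∈ weightLE k 1 0 n := by
  rw [degreeOf_eq_sup, Finset.sup_le_iff]
  simp [mem_weightLE, wt]

theorem degreeOf_one_le {n : ℕ} {f : MvPolynomial (Fin 2) k} :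
    degreeOf 1 f ≤ n ↔ f ∈ weightLE k 0 1 n := by
  rw [degreeOf_eq_sup, Finset.sup_le_iff]
  simp [mem_weightLE, wt]

theorem C_mul_X_zero_pow_notMem {c : k} (hc : c ≠ 0) {n : ℕ} {W : ℤ} (hW : W < u * n) :
    C c * X 0 ^ n ∉ weightLE k u v W := by
  classical
  intro h
  have := h (Finsupp.single 0 n) (by
    rw [mem_support_iff, coeff_C_mul, coeff_X_pow]; simpa using hc)
  simp [wt] at this
  omega

theorem C_mul_X_one_pow_notMem {c : k} (hc : c ≠ 0) {n : ℕ} {W : ℤ} (hW : W < v * n) :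
    C c * X 1 ^ n ∉ weightLE k u v W := by
  classical
  intro h
  have := h (Finsupp.single 1 n) (by
    rw [mem_support_iff, coeff_C_mul, coeff_X_pow]; simpa using hc)
  simp [wt] at this
  omega

theorem aeval_X_zero_mem_weightLE (g : Polynomial k) :
    Polynomial.aeval (X 0 : MvPolynomial (Fin 2) k) g ∈ weightLE k 1 0 g.natDegree := by
  rw [Polynomial.aeval_eq_sum_range]
  refine Submodule.sum_mem _ fun i hi => Submodule.smul_mem _ _ ?_
  refine weightLE_mono ?_ (pow_mem_weightLE X_zero_mem_weightLE i)
  have := Finset.mem_range.1 hi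
  omega

theorem aeval_X_zero_mem_weightLE_zero (v : ℤ) (g : Polynomial k) :
    Polynomial.aeval (X 0 : MvPolynomial (Fin 2) k) g ∈ weightLE k 0 v 0 := by
  rw [Polynomial.aeval_eq_sum_range]
  refine Submodule.sum_mem _ fun i _ => Submodule.smul_mem _ _ ?_
  simpa using pow_mem_weightLE (X_zero_mem_weightLE (k := k) (u := 0) (v := v)) i

theorem exists_eq_aeval_X_one {f : MvPolynomial (Fin 2) k} (hf : f ∈ weightLE k 1 0 0) :
    ∃ g : Polynomial k, f = Polynomial.aeval (X 1) g := by
  refine ⟨aeval ![0, Polynomial.X] f, ?_⟩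
  have h1 : (![X 0, X 1] : Fin 2 → MvPolynomial (Fin 2) k) = X := by
    funext j; fin_cases j <;> rfl
  conv_lhs => rw [← aeval_X_left_apply f, ← h1]
  rw [aeval_pair_eq_sum, aeval_pair_eq_sum, map_sum]
  refine Finset.sum_congr rfl fun d hd => ?_
  have h2 : d 0 = 0 := by
    have := hf d hd
    simp [wt] at this
    exact this
  simp [h2]

theorem exists_eq_aeval_X_zero {f : MvPolynomial (Fin 2) k} (hf : f ∈ weightLE k 0 1 0) :
    ∃ g : Polynomial k, f = Polynomial.aeval (X 0) g := by
  refine ⟨aeval ![Polynomial.X, 0] f, ?_⟩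
  have h1 : (![X 0, X 1] : Fin 2 → MvPolynomial (Fin 2) k) = X := by
    funext j; fin_cases j <;> rfl
  conv_lhs => rw [← aeval_X_left_apply f, ← h1]
  rw [aeval_pair_eq_sum, aeval_pair_eq_sum, map_sum]
  refine Finset.sum_congr rfl fun d hd => ?_
  have h2 : d 1 = 0 := by
    have := hf d hd
    simp [wt] at this
    exact this
  simp [h2]

end WeightLE

/-! ### Action of the shears -/

section Shears

open MvPolynomial

variable {k : Type*} [Field k]

theorem shearFst_apply (g : Polynomial k) (F : MvPolynomial (Fin 2) k) :
    shearFst g F = aeval ![X 0 + Polynomial.aeval (X 1) g, X 1] F := rfl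

theorem shearSnd_apply (g : Polynomial k) (F : MvPolynomial (Fin 2) k) :
    shearSnd g F = aeval ![X 0, X 1 + Polynomial.aeval (X 0) g] F := rfl

theorem translation_apply (t : k) (F : MvPolynomial (Fin 2) k) :
    translation t F = aeval ![X 0 + C t, X 1] F := rfl

theorem diagAff_apply (a : kˣ) (u₁ u₂ : k) (F : MvPolynomial (Fin 2) k) :
    diagAff a u₁ u₂ F = aeval ![X 0 + C u₁, C (a : k) * X 1 + C u₂] F := rfl

theorem aut_ext {φ ψ : Aut2 k} (h0 : φ (X 0) = ψ (X 0)) (h1 : φ (X 1) = ψ (X 1)) : φ = ψ := by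
  have : (φ : MvPolynomial (Fin 2) k →ₐ[k] MvPolynomial (Fin 2) k) = ψ := hom_ext h0 h1
  exact AlgEquiv.ext fun f => DFunLike.congr_fun this f

theorem shearSnd_mul_shearSnd (g h : Polynomial k) :
    shearSnd g * shearSnd h = shearSnd (g + h) := by
  refine aut_ext ?_ ?_
  · simp [AlgEquiv.mul_apply, shearSnd_apply]
  · simp [AlgEquiv.mul_apply, shearSnd_apply, ← Polynomial.aeval_algHom_apply, add_assoc]

theorem shearSnd_zero : shearSnd (0 : Polynomial k) = 1 := by
  refine aut_ext ?_ ?_ <;> simp [shearSnd_apply]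

theorem degreeOf_one_shearSnd_le (g : Polynomial k) (F : MvPolynomial (Fin 2) k) :
    degreeOf 1 (shearSnd g F) ≤ degreeOf 1 F := by
  rw [degreeOf_one_le, shearSnd_apply]
  exact aeval_mem_weightLE X_zero_mem_weightLE
    (Submodule.add_mem _ X_one_mem_weightLE
      (weightLE_mono zero_le_one (aeval_X_zero_mem_weightLE_zero 1 g)))
    (degreeOf_one_le.1 le_rfl)

theorem shearSnd_shearSnd_neg (g : Polynomial k) (F : MvPolynomial (Fin 2) k) :
    shearSnd (-g) (shearSnd g F) = F := by
  rw [← AlgEquiv.mul_apply, shearSnd_mul_shearSnd, neg_add_cancel, shearSnd_zero]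
  rfl

theorem degreeOf_one_shearSnd (g : Polynomial k) (F : MvPolynomial (Fin 2) k) :
    degreeOf 1 (shearSnd g F) = degreeOf 1 F := by
  refine le_antisymm (degreeOf_one_shearSnd_le g F) ?_
  conv_lhs => rw [← shearSnd_shearSnd_neg g F]
  exact degreeOf_one_shearSnd_le _ _

end Shears

/-! ### Degrees read off from a binomial top form -/

section BinomialTopForm

open MvPolynomial

variable {k : Type*} [Field k]

/-- `F` has the top form `c (x₁ᵃ - α x₂ᵇ)ᴸ`. -/
structure HasBinomialTop (F : MvPolynomial (Fin 2) k) (a b L : ℕ) (c α : k) : Prop where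
  a_ne : a ≠ 0
  b_ne : b ≠ 0
  L_ne : L ≠ 0
  c_ne : c ≠ 0
  α_ne : α ≠ 0
  mem : F - C c * (X 0 ^ a - C α * X 1 ^ b) ^ L ∈ weightLE k b a (a * b * L - 1)

theorem exists_hasBinomialTop (p : ℕ) [Fact p.Prime] [CharP k p] (φ : Aut2 k) (i : Fin 2)
    (h0 : degreeOf 0 (φ (X i)) ≠ 0) (h1 : degreeOf 1 (φ (X i)) ≠ 0) :
    ∃ a b L c α, HasBinomialTop (φ (X i)) a b L c α ∧ (a = 1 ∨ b = 1) := by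
  obtain ⟨a, b, L, ha, hb, hL, hab, c, α, hc, hα, h⟩ := exists_binomial_top_form p φ i h0 h1
  refine ⟨a, b, L, c, α, ⟨ha, hb, hL, hc, hα, fun d hd => ?_⟩, hab⟩
  have := h d hd
  zify at this
  simp only [wt]
  omega

namespace HasBinomialTop

variable {F : MvPolynomial (Fin 2) k} {a b L : ℕ} {c α : k}

theorem mem_weightLE_self (h : HasBinomialTop F a b L c α) :
    F ∈ weightLE k b a (a * b * L) := by
  have h1 : (X 0 ^ a - C α * X 1 ^ b : MvPolynomial (Fin 2) k) ∈ weightLE k b a (a * b) := by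
    refine Submodule.sub_mem _ ?_ (C_mul_mem_weightLE _ ?_)
    · rw [mul_comm]; exact pow_mem_weightLE X_zero_mem_weightLE a
    · exact pow_mem_weightLE X_one_mem_weightLE b
  have h2 := Submodule.add_mem _ (weightLE_mono (by omega) h.mem)
    (C_mul_mem_weightLE c (pow_mem_weightLE h1 L))
  simpa using h2

/-- The weight bounds the degree from above. It is attained because setting x₂ = 0 turns the top
form into c·x₁ᵃᴸ, while the remainder has smaller degree in x₁. -/
theorem degreeOf_zero (h : HasBinomialTop F a b L c α) : degreeOf 0 F = a * L := by
  have hapos := Nat.pos_of_ne_zero h.a_ne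
  have hbpos := Nat.pos_of_ne_zero h.b_ne
  refine le_antisymm (degreeOf_zero_le.2 fun d hd => ?_) ?_
  · have h1 := h.mem_weightLE_self d hd
    simp only [wt] at h1 ⊢
    have h2 : b * d 0 ≤ b * (a * L) := by
      zify; nlinarith [Nat.cast_nonneg (α := ℤ) (d 1)]
    have h3 := le_of_mul_le_mul_left h2 hbpos
    zify at h3
    push_cast
    linarith
  · by_contra! hlt
    have h1 : F ∈ weightLE k 1 0 ((a * L : ℤ) - 1) := by
      refine weightLE_mono ?_ (degreeOf_zero_le.1 le_rfl)
      zify at hlt; omega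
    have h2 : F - C c * (X 0 ^ a - C α * X 1 ^ b) ^ L ∈ weightLE k 1 0 ((a * L : ℤ) - 1) := by
      intro d hd
      have h3 := h.mem d hd
      simp only [wt] at h3 ⊢
      have h4 : b * d 0 < b * (a * L) := by
        zify; nlinarith [Nat.cast_nonneg (α := ℤ) (d 1)]
      have h5 := lt_of_mul_lt_mul_left h4 (Nat.zero_le b)
      zify at h5
      omega
    have h3 := Submodule.sub_mem _ h1 h2
    rw [sub_sub_cancel] at h3
    have h4 := aeval_mem_weightLE (u := 1) (v := 0) X_zero_mem_weightLE (Submodule.zero_mem _) h3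
    have h5 : aeval ![(X 0 : MvPolynomial (Fin 2) k), 0]
        (C c * (X 0 ^ a - C α * X 1 ^ b) ^ L) = C c * X 0 ^ (a * L) := by
      simp [h.b_ne, pow_mul, algebraMap_eq]
    rw [h5] at h4
    exact C_mul_X_zero_pow_notMem h.c_ne (by push_cast; omega) h4

theorem degreeOf_one (h : HasBinomialTop F a b L c α) : degreeOf 1 F = b * L := by
  have hapos := Nat.pos_of_ne_zero h.a_ne
  have hbpos := Nat.pos_of_ne_zero h.b_ne
  refine le_antisymm (degreeOf_one_le.2 fun d hd => ?_) ?_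
  · have h1 := h.mem_weightLE_self d hd
    simp only [wt] at h1 ⊢
    have h2 : a * d 1 ≤ a * (b * L) := by
      zify; nlinarith [Nat.cast_nonneg (α := ℤ) (d 0)]
    have h3 := le_of_mul_le_mul_left h2 hapos
    zify at h3
    push_cast
    linarith
  · by_contra! hlt
    have h1 : F ∈ weightLE k 0 1 ((b * L : ℤ) - 1) := by
      refine weightLE_mono ?_ (degreeOf_one_le.1 le_rfl)
      zify at hlt; omega
    have h2 : F - C c * (X 0 ^ a - C α * X 1 ^ b) ^ L ∈ weightLE k 0 1 ((b * L : ℤ) - 1) := by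
      intro d hd
      have h3 := h.mem d hd
      simp only [wt] at h3 ⊢
      have h4 : a * d 1 < a * (b * L) := by
        zify; nlinarith [Nat.cast_nonneg (α := ℤ) (d 0)]
      have h5 := lt_of_mul_lt_mul_left h4 (Nat.zero_le a)
      zify at h5
      omega
    have h3 := Submodule.sub_mem _ h1 h2
    rw [sub_sub_cancel] at h3
    have h4 := aeval_mem_weightLE (u := 0) (v := 1) (Submodule.zero_mem _) X_one_mem_weightLE h3
    have h5 : aeval ![0, (X 1 : MvPolynomial (Fin 2) k)]
        (C c * (X 0 ^ a - C α * X 1 ^ b) ^ L) = C (c * (-α) ^ L) * X 1 ^ (b * L) := by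
      simp [h.a_ne, pow_mul, algebraMap_eq, ← neg_mul, mul_pow]
      ring
    rw [h5] at h4
    exact C_mul_X_one_pow_notMem (mul_ne_zero h.c_ne (pow_ne_zero _ (neg_ne_zero.2 h.α_ne)))
      (by push_cast; omega) h4

end HasBinomialTop

end BinomialTopForm

/-! ### Translation-invariant univariate polynomials -/

section Univariate

open Polynomial

variable {k : Type*} [Field k]

/-- The univariate polynomials of degree at most `W`. -/
def univLE (k : Type*) [Field k] (W : ℤ) : Submodule k k[X] where
  carrier := {f | ∀ n : ℕ, f.coeff n ≠ 0 → (n : ℤ) ≤ W}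
  zero_mem' := by simp
  add_mem' := by
    intro f g hf hg n hn
    by_cases h : f.coeff n = 0
    · exact hg n fun h' => hn (by simp [h, h'])
    · exact hf n h
  smul_mem' := fun c f hf n hn => hf n fun h => hn (by simp [h])

theorem univLE_mono : Monotone (univLE k) := fun _ _ h _ hf n hn => (hf n hn).trans h

theorem natDegree_mem_univLE {f : k[X]} {n : ℕ} (h : f.natDegree ≤ n) : f ∈ univLE k n :=
  fun _ hm => by exact_mod_cast (le_natDegree_of_ne_zero hm).trans h

theorem mul_mem_univLE {m n : ℤ} {f g : k[X]} (hf : f ∈ univLE k m) (hg : g ∈ univLE k n) :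
    f * g ∈ univLE k (m + n) := by
  intro i hi
  rw [coeff_mul] at hi
  obtain ⟨⟨i₁, i₂⟩, h, h1⟩ := Finset.exists_ne_zero_of_sum_ne_zero hi
  rw [Finset.HasAntidiagonal.mem_antidiagonal] at h
  subst h
  push_cast
  exact add_le_add (hf _ (left_ne_zero_of_mul h1)) (hg _ (right_ne_zero_of_mul h1))

theorem aeval_mem_univLE {u v W : ℤ} {P Q : k[X]} {F : MvPolynomial (Fin 2) k}
    (hP : P ∈ univLE k u) (hQ : Q ∈ univLE k v) (hF : F ∈ weightLE k u v W) :
    MvPolynomial.aeval ![P, Q] F ∈ univLE k W :=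
  aeval_mem_family (S := univLE k) (natDegree_mem_univLE (by simp))
    (fun _ _ _ _ => mul_mem_univLE) hP hQ fun d hd => univLE_mono (hF d hd)

theorem comp_X_add_C_artinSchreier (p : ℕ) [Fact p.Prime] [CharP k p] (t : k) :
    (X ^ p - C (t ^ (p - 1)) * X : k[X]).comp (X + C t) = X ^ p - C (t ^ (p - 1)) * X := by
  have hp : p.Prime := Fact.out
  have h1 : t ^ p = t ^ (p - 1) * t := by rw [← pow_succ]; congr 1; have := hp.pos; omega
  simp only [sub_comp, pow_comp, X_comp, mul_comp, C_comp, add_pow_char]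
  rw [← C_pow (a := t) (n := p), h1, C_mul]
  ring

/-- The polynomials invariant under the translation by `t` are the polynomials in
`xᵖ - tᵖ⁻¹ x`. -/
theorem exists_eq_comp_of_comp_X_add_C (p : ℕ) [Fact p.Prime] [CharP k p] {t : k} (ht : t ≠ 0)
    (R : k[X]) (hR : R.comp (X + C t) = R) :
    ∃ Q : k[X], R = Q.comp (X ^ p - C (t ^ (p - 1)) * X) := by
  classical
  have hp : p.Prime := Fact.out
  set Y : k[X] := X ^ p - C (t ^ (p - 1)) * X with hY
  have hYt : Y.comp (X + C t) = Y := comp_X_add_C_artinSchreier p t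
  have hlt : (C (t ^ (p - 1)) * X : k[X]).degree < p :=
    (degree_C_mul_X_le _).trans_lt (by exact_mod_cast hp.one_lt)
  have hYm : Y.Monic := monic_X_pow_sub hlt
  have hYdeg : Y.degree = p := by
    rw [hY, degree_sub_eq_left_of_degree_lt (by rwa [degree_X_pow]), degree_X_pow]
  induction hn : R.natDegree using Nat.strong_induction_on generalizing R with
  | _ n ih =>
  subst hn
  have hdiv := modByMonic_add_div R Y
  have hmodlt : (R %ₘ Y).degree < Y.degree := degree_modByMonic_lt _ hYm
  -- `Y` is invariant, so by uniqueness of division with remainder the quotient and remainder of R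
  -- by `Y` are invariant too.
  have huniq := div_modByMonic_unique ((R /ₘ Y).comp (X + C t)) ((R %ₘ Y).comp (X + C t)) hYm
    (f := R) ⟨by
      conv_rhs => rw [← hR, ← hdiv]
      rw [add_comp, mul_comp, hYt], by
      by_cases h0 : R %ₘ Y = 0
      · rw [h0, zero_comp, degree_zero, hYdeg]; exact WithBot.bot_lt_coe p
      · refine lt_of_le_of_lt ?_ hmodlt
        refine degree_le_of_natDegree_le ?_ |>.trans (degree_eq_natDegree h0).ge
        rw [natDegree_comp, natDegree_X_add_C, mul_one]⟩
  obtain ⟨hq, hr⟩ := huniq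
  -- The remainder has degree less than p and takes the same value at the p distinct points 0, t,
  -- ..., (p - 1)t.
  have hconst : R %ₘ Y = C ((R %ₘ Y).coeff 0) := by
    set r := R %ₘ Y
    have heval : ∀ n : ℕ, r.eval (n * t) = r.eval 0 := by
      intro n
      induction n with
      | zero => simp
      | succ n ihn =>
        rw [← ihn]
        conv_rhs => rw [hr]
        simp [eval_comp, add_mul]
    have hinj : Set.InjOn (fun n : ℕ => (n : k) * t) (Finset.range p) := by
      intro m hm n hn hmn
      have h1 := mul_right_cancel₀ ht hmn
      exact CharP.natCast_injOn_Iio k p (by simpa using hm) (by simpa using hn) h1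
    refine eq_of_degree_sub_lt_of_eval_finset_eq ((Finset.range p).image fun n : ℕ => (n : k) * t)
      ?_ ?_
    · rw [Finset.card_image_of_injOn hinj, Finset.card_range]
      refine (degree_sub_le _ _).trans_lt (max_lt (hYdeg ▸ hmodlt) ?_)
      exact degree_C_le.trans_lt (by exact_mod_cast hp.pos)
    · intro x hx
      obtain ⟨n, -, rfl⟩ := Finset.mem_image.1 hx
      rw [heval, eval_C, coeff_zero_eq_eval_zero]
  by_cases h0 : R.natDegree = 0
  · exact ⟨R, by rw [eq_C_of_natDegree_eq_zero h0]; simp⟩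
  · have hnat : (R /ₘ Y).natDegree < R.natDegree := by
      rw [natDegree_divByMonic _ hYm, natDegree_eq_of_degree_eq_some hYdeg]
      have := hp.pos
      omega
    obtain ⟨Q, hQ⟩ := ih _ hnat (R /ₘ Y) hq.symm rfl
    refine ⟨C ((R %ₘ Y).coeff 0) + X * Q, ?_⟩
    rw [add_comp, C_comp, mul_comp, X_comp, ← hQ, ← hconst]
    exact hdiv.symm

end Univariate

/-! ### Consequences of the binomial top form -/

section Coordinates

open MvPolynomial

variable {k : Type*} [Field k]

/-- Applying φ⁻¹ gives g(φ⁻¹(xⱼ)) = xᵢ. Setting both variables equal to x makes x a composite g ∘ q,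
and degrees multiply. -/
theorem natDegree_eq_one_of_aeval_eq (φ : Aut2 k) (i j : Fin 2) (g : Polynomial k)
    (h : φ (X i) = Polynomial.aeval (X j) g) : g.natDegree = 1 := by
  have h1 : Polynomial.aeval (φ.symm (X j)) g = X i := by
    have h2 := congrArg φ.symm h
    rw [AlgEquiv.symm_apply_apply] at h2
    rw [h2]
    exact Polynomial.aeval_algHom_apply
      (φ.symm : MvPolynomial (Fin 2) k →ₐ[k] MvPolynomial (Fin 2) k) _ _
  have h2 := congrArg (aeval fun _ => (Polynomial.X : Polynomial k)) h1
  rw [← Polynomial.aeval_algHom_apply, aeval_X, ← Polynomial.comp_eq_aeval] at h2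
  have h3 := congrArg Polynomial.natDegree h2
  rw [Polynomial.natDegree_comp, Polynomial.natDegree_X] at h3
  exact Nat.eq_one_of_mul_eq_one_right h3

theorem exists_eq_C_mul_X_add_C (φ : Aut2 k) (i j : Fin 2) (g : Polynomial k)
    (h : φ (X i) = Polynomial.aeval (X j) g) :
    ∃ b c : k, b ≠ 0 ∧ φ (X i) = C b * X j + C c := by
  have hg := natDegree_eq_one_of_aeval_eq φ i j g h
  obtain ⟨b, hb, c, rfl⟩ := Polynomial.natDegree_eq_one.1 hg
  exact ⟨b, c, hb, by rw [h]; simp [algebraMap_eq]⟩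

/-- An automorphism mapping `x₂` to a polynomial `b x₂ + e` maps `x₁` to a polynomial
`c x₁ + g(x₂)`. -/
theorem exists_eq_C_mul_X_zero_add (p : ℕ) [Fact p.Prime] [CharP k p] (φ : Aut2 k) {b e : k}
    (hb : b ≠ 0) (h : φ (X 1) = C b * X 1 + C e) :
    ∃ (c : k) (g : Polynomial k), φ (X 0) = C c * X 0 + Polynomial.aeval (X 1) g := by
  set f := φ (X 0) with hf
  -- The coordinate f + (b x₂ + e)ᴹ has degree M in x₂, a prime exceeding the degrees of f. In its
  -- top form, L divides M but is at most deg_{x₁} f, so L = 1; thus the x₂-exponent is M and a = 1.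
  -- The remainder has weight less than M for the weights (M, 1), so it is free of x₁.
  obtain ⟨M, hM, hMp⟩ := Nat.exists_infinite_primes (degreeOf 0 f + degreeOf 1 f + 1)
  have hlin : C b * X 1 + C e ∈ weightLE k 0 1 1 :=
    Submodule.add_mem _ (C_mul_mem_weightLE _ X_one_mem_weightLE)
      (weightLE_mono zero_le_one (C_mem_weightLE e))
  have hlin0 : C b * X 1 + C e ∈ weightLE k 1 0 0 :=
    Submodule.add_mem _ (C_mul_mem_weightLE _ X_one_mem_weightLE) (C_mem_weightLE e)
  have hpow0 : (C b * X 1 + C e) ^ M ∈ weightLE k 1 0 0 := by simpa using pow_mem_weightLE hlin0 M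
  have hF : (φ * shearFst (Polynomial.X ^ M) : Aut2 k) (X 0) = f + (C b * X 1 + C e) ^ M := by
    simp [AlgEquiv.mul_apply, shearFst_apply, h, hf]
  -- If f were free of x₁, the image of φ would lie in k[x₂].
  have hf0 : f ∉ weightLE k 1 0 0 := by
    intro hf0
    have h1 : φ (φ.symm (X 0)) ∈ weightLE k 1 0 0 := by
      have h2 : (φ : MvPolynomial (Fin 2) k →ₐ[k] MvPolynomial (Fin 2) k) =
          aeval ![f, C b * X 1 + C e] :=
        hom_ext (by simp [hf]) (by simp [h])
      have h3 := aeval_mem_weightLE (u' := 0) (v' := 0) (W := 0) (F := φ.symm (X 0)) hf0 hlin0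
        (fun d _ => by simp [wt])
      rw [← h2] at h3
      exact h3
    rw [AlgEquiv.apply_symm_apply] at h1
    exact C_mul_X_zero_pow_notMem (k := k) (u := 1) (v := 0) one_ne_zero (n := 1) (W := 0)
      (by norm_num) (by simpa using h1)
  have hFdeg0 : degreeOf 0 (f + (C b * X 1 + C e) ^ M) ≤ degreeOf 0 f := by
    rw [degreeOf_zero_le]
    exact Submodule.add_mem _ (degreeOf_zero_le.1 le_rfl) (weightLE_mono (by positivity) hpow0)
  have hFdeg0' : degreeOf 0 (f + (C b * X 1 + C e) ^ M) ≠ 0 := by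
    intro h0
    have h1 := degreeOf_zero_le.1 h0.le
    exact hf0 (by simpa using Submodule.sub_mem _ h1 hpow0)
  have hFdeg1 : degreeOf 1 (f + (C b * X 1 + C e) ^ M) = M := by
    refine le_antisymm (degreeOf_one_le.2 (Submodule.add_mem _
      (weightLE_mono (by omega) (degreeOf_one_le.1 le_rfl))
      (by simpa using pow_mem_weightLE hlin M))) ?_
    by_contra! hlt
    have h1 : f + (C b * X 1 + C e) ^ M ∈ weightLE k 0 1 (M - 1) :=
      weightLE_mono (by omega) (degreeOf_one_le.1 le_rfl)
    have h2 : f ∈ weightLE k 0 1 (M - 1) := weightLE_mono (by omega) (degreeOf_one_le.1 le_rfl)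
    have h3 := Submodule.sub_mem _ h1 h2
    rw [add_sub_cancel_left] at h3
    have h4 := aeval_mem_weightLE (u := 0) (v := 1) (P := X 0) (Q := C b⁻¹ * (X 1 - C e))
      X_zero_mem_weightLE (C_mul_mem_weightLE _ (Submodule.sub_mem _ X_one_mem_weightLE
        (weightLE_mono zero_le_one (C_mem_weightLE e)))) h3
    have h5 : aeval ![X 0, C b⁻¹ * (X 1 - C e)] ((C b * X 1 + C e) ^ M) =
        (C 1 * X 1 ^ M : MvPolynomial (Fin 2) k) := by
      simp [algebraMap_eq, ← mul_assoc, ← C_mul, hb]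
    rw [h5] at h4
    exact C_mul_X_one_pow_notMem one_ne_zero (by omega) h4
  obtain ⟨a, b', L, c, α, htop, hab⟩ := exists_hasBinomialTop p (φ * shearFst (Polynomial.X ^ M)) 0
    (by rwa [hF]) (by rw [hF, hFdeg1]; exact hMp.ne_zero)
  rw [hF] at htop
  have e0 := htop.degreeOf_zero
  have e1 := htop.degreeOf_one
  rw [hFdeg1] at e1
  have ha := Nat.pos_of_ne_zero htop.a_ne
  have hL1 : L = 1 := by
    rcases (Nat.dvd_prime hMp).1 (e1 ▸ Dvd.intro_left b' rfl : L ∣ M) with h1 | h1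
    · exact h1
    · have := Nat.le_mul_of_pos_left L ha
      omega
  subst hL1
  rw [mul_one] at e1
  subst e1
  have ha1 : a = 1 := hab.resolve_right hMp.one_lt.ne'
  subst ha1
  have hmem := htop.mem
  have h6 : f - C c * X 0 ∈ weightLE k 1 0 0 := by
    have h7 : f + (C b * X 1 + C e) ^ M - C c * (X 0 ^ 1 - C α * X 1 ^ M) ^ 1 ∈
        weightLE k 1 0 0 := by
      intro d hd
      have h8 := hmem d hd
      simp only [wt, Nat.cast_one] at h8 ⊢
      have h9 : (M : ℤ) * d 0 < M * 1 := by
        have := Nat.cast_nonneg (α := ℤ) (d 1)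
        linarith
      have := lt_of_mul_lt_mul_left h9 (by positivity)
      omega
    have h8 : C c * (C α * X 1 ^ M) ∈ weightLE k 1 0 0 :=
      C_mul_mem_weightLE _ (C_mul_mem_weightLE _ (by
        simpa using pow_mem_weightLE (X_one_mem_weightLE (k := k) (u := 1) (v := 0)) M))
    have h9 := Submodule.sub_mem _ (Submodule.sub_mem _ h7 hpow0) h8
    convert h9 using 1
    ring
  obtain ⟨g, hg⟩ := exists_eq_aeval_X_one h6
  exact ⟨c, g, by rw [← hg]; ring⟩

/-- A suitable shear `(x₁, x₂ + P(x₁))` transforms a coordinate into one whose Newton polygon is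
flat. -/
theorem exists_shearSnd_mem_weightLE (p : ℕ) [Fact p.Prime] [CharP k p] (φ : Aut2 k) (i : Fin 2)
    (h1 : degreeOf 1 (φ (X i)) ≠ 0) :
    ∃ P : Polynomial k,
      shearSnd P (φ (X i)) ∈ weightLE k 2 1 (degreeOf 1 (φ (X i))) := by
  set F := φ (X i)
  -- `P` makes the degree in x₁ after the shear as small as possible.
  let P := Function.argmin fun P : Polynomial k => degreeOf 0 (shearSnd P F)
  have hmin : ∀ P', degreeOf 0 (shearSnd P F) ≤ degreeOf 0 (shearSnd P' F) := fun P' =>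
    Function.argmin_le (fun P : Polynomial k => degreeOf 0 (shearSnd P F)) P'
  refine ⟨P, ?_⟩
  have hdeg1 := degreeOf_one_shearSnd P F
  set G := shearSnd P F with hG
  by_cases h0 : degreeOf 0 G = 0
  · have m0 := degreeOf_zero_le.1 h0.le
    have m1 := degreeOf_one_le.1 hdeg1.le
    intro d hd
    have e0 := m0 d hd
    have e1 := m1 d hd
    simp only [wt] at e0 e1 ⊢
    push_cast at e0
    linarith
  · obtain ⟨a, b, L, c, α, htop, hab⟩ := exists_hasBinomialTop p (shearSnd P * φ) i
      (by rwa [AlgEquiv.mul_apply]) (by rw [AlgEquiv.mul_apply]; exact hdeg1 ▸ h1)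
    rw [AlgEquiv.mul_apply] at htop
    change HasBinomialTop G a b L c α at htop
    have e0 := htop.degreeOf_zero
    have e1 := htop.degreeOf_one
    have ha := Nat.pos_of_ne_zero htop.a_ne
    have hL := Nat.pos_of_ne_zero htop.L_ne
    -- If b = 1, the further shear by α⁻¹x₁ᵃ turns the top form into a multiple of x₂ᴸ and keeps the
    -- rest below weight aL, contradicting minimality. So a = 1 and b ≥ 2, which is the flatness
    -- claimed.
    have hb1 : b ≠ 1 := by
      rintro rfl
      have h2 := hmin (Polynomial.C α⁻¹ * Polynomial.X ^ a + P)
      rw [← shearSnd_mul_shearSnd, AlgEquiv.mul_apply, ← hG, e0] at h2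
      have h3 : shearSnd (Polynomial.C α⁻¹ * Polynomial.X ^ a) G ∈
          weightLE k 1 0 ((a * L : ℤ) - 1) := by
        have m1 := aeval_mem_weightLE (u := 1) (v := a) (P := X 0)
          (Q := X 1 + Polynomial.aeval (X 0) (Polynomial.C α⁻¹ * Polynomial.X ^ a))
          (u' := (1 : ℕ)) (v' := a) (by simpa using X_zero_mem_weightLE)
          (Submodule.add_mem _ X_one_mem_weightLE (by
            simp only [map_mul, map_pow, Polynomial.aeval_C, Polynomial.aeval_X, algebraMap_eq]
            refine C_mul_mem_weightLE _ ?_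
            simpa using pow_mem_weightLE (X_zero_mem_weightLE (k := k) (u := 1) (v := a)) a))
          htop.mem
        rw [← shearSnd_apply, map_sub] at m1
        have m2 : shearSnd (Polynomial.C α⁻¹ * Polynomial.X ^ a)
            (C c * (X 0 ^ a - C α * X 1 ^ 1) ^ L) = C (c * (-α) ^ L) * X 1 ^ L := by
          have : (C α * C α⁻¹ : MvPolynomial (Fin 2) k) = 1 := by
            rw [← C_mul, mul_inv_cancel₀ htop.α_ne, C_1]
          simp only [shearSnd_apply, map_mul, map_pow, map_sub, aeval_C, aeval_X, algebraMap_eq,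
            Polynomial.aeval_C, Polynomial.aeval_X, Matrix.cons_val_zero, Matrix.cons_val_one,
            pow_one, map_neg]
          rw [mul_assoc, ← mul_pow]
          congr 2
          linear_combination (-(X 0 ^ a)) * this
        have m3 : shearSnd (Polynomial.C α⁻¹ * Polynomial.X ^ a)
            (G - C c * (X 0 ^ a - C α * X 1 ^ 1) ^ L) ∈ weightLE k 1 0 ((a * L : ℤ) - 1) := by
          rw [map_sub]
          intro d hd
          have := m1 d hd
          simp only [wt, Nat.cast_one] at this ⊢
          nlinarith [Nat.cast_nonneg (α := ℤ) (d 1), Nat.cast_nonneg (α := ℤ) a]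
        have m4 : C (c * (-α) ^ L) * X 1 ^ L ∈ weightLE k 1 0 ((a * L : ℤ) - 1) := by
          refine C_mul_mem_weightLE _ (weightLE_mono ?_ (pow_mem_weightLE X_one_mem_weightLE L))
          have : 0 < (a * L : ℤ) := by positivity
          omega
        rw [map_sub, m2] at m3
        simpa using Submodule.add_mem _ m3 m4
      have h4 : degreeOf 0 (shearSnd (Polynomial.C α⁻¹ * Polynomial.X ^ a) G) ≤ a * L - 1 := by
        have : 0 < a * L := by positivity
        rw [degreeOf_zero_le]
        refine weightLE_mono ?_ h3
        push_cast [Nat.cast_sub (show 1 ≤ a * L by omega)]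
        exact le_rfl
      have : 0 < a * L := by positivity
      omega
    have ha1 := hab.resolve_right hb1
    subst ha1
    have hb2 : 2 ≤ b := by have := htop.b_ne; omega
    intro d hd
    have h2 := htop.mem_weightLE_self d hd
    rw [← hdeg1, e1]
    simp only [wt, Nat.cast_one] at h2 ⊢
    push_cast
    nlinarith [Nat.cast_nonneg (α := ℤ) (d 0)]

end Coordinates

/-! ### The centralizer and the descent -/

section Centralizer

open MvPolynomial

variable {k : Type*} [Field k]

theorem comp_artinSchreier_comp_X_add_C (p : ℕ) [Fact p.Prime] [CharP k p] (t : k)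
    (g : Polynomial k) :
    (g.comp (Polynomial.X ^ p - Polynomial.C (t ^ (p - 1)) * Polynomial.X)).comp
      (Polynomial.X + Polynomial.C t) =
        g.comp (Polynomial.X ^ p - Polynomial.C (t ^ (p - 1)) * Polynomial.X) := by
  rw [Polynomial.comp_assoc, comp_X_add_C_artinSchreier]

theorem aeval_X_zero_add_C (t : k) (R : Polynomial k) :
    Polynomial.aeval (X 0 + C t : MvPolynomial (Fin 2) k) R =
      Polynomial.aeval (X 0) (R.comp (Polynomial.X + Polynomial.C t)) := by
  rw [Polynomial.aeval_comp]
  simp [algebraMap_eq]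

theorem mem_centralizer_translation {t : k} {φ : Aut2 k} :
    φ ∈ Subgroup.centralizer {translation t} ↔
      ∀ f, translation t (φ f) = φ (translation t f) := by
  rw [Subgroup.mem_centralizer_singleton_iff, eq_comm]
  exact AlgEquiv.ext_iff

theorem shearFst_mem_centralizer (t : k) (g : Polynomial k) :
    shearFst g ∈ Subgroup.centralizer {translation t} := by
  rw [Subgroup.mem_centralizer_singleton_iff]
  refine aut_ext ?_ ?_
  · simp only [AlgEquiv.mul_apply, shearFst_apply, translation_apply]
    simp [← Polynomial.aeval_algHom_apply, algebraMap_eq]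
    ring
  · simp [AlgEquiv.mul_apply, shearFst_apply, translation_apply]

theorem shearSnd_mem_centralizer (t : k) {g : Polynomial k}
    (hg : g.comp (Polynomial.X + Polynomial.C t) = g) :
    shearSnd g ∈ Subgroup.centralizer {translation t} := by
  rw [Subgroup.mem_centralizer_singleton_iff]
  refine aut_ext ?_ ?_
  · simp [AlgEquiv.mul_apply, shearSnd_apply, translation_apply, algebraMap_eq]
  · simp only [AlgEquiv.mul_apply, shearSnd_apply, translation_apply]
    simp [← Polynomial.aeval_algHom_apply, aeval_X_zero_add_C, hg]

theorem diagAff_mem_centralizer (t : k) (a : kˣ) (u₁ u₂ : k) :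
    diagAff a u₁ u₂ ∈ Subgroup.centralizer {translation t} := by
  rw [Subgroup.mem_centralizer_singleton_iff]
  refine aut_ext ?_ ?_
  · simp [AlgEquiv.mul_apply, diagAff_apply, translation_apply, algebraMap_eq]
    ring
  · simp [AlgEquiv.mul_apply, diagAff_apply, translation_apply, algebraMap_eq]

theorem H_le_centralizer (p : ℕ) [Fact p.Prime] [CharP k p] (t : k) :
    H p t ≤ Subgroup.centralizer {translation t} := by
  rw [H, Subgroup.closure_le]
  rintro φ (⟨g, -, rfl⟩ | ⟨g, -, rfl⟩)
  · exact shearFst_mem_centralizer t g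
  · exact shearSnd_mem_centralizer t (comp_artinSchreier_comp_X_add_C p t g)

/-- If a translation-invariant polynomial becomes flat after the shear `(x₁, x₂ + P(x₁))`, then the
translation changes `P` by a constant. -/
theorem natDegree_comp_X_add_C_sub_eq_zero {t : k} {F : MvPolynomial (Fin 2) k}
    (hF : translation t F = F) (h1 : degreeOf 1 F ≠ 0) {P : Polynomial k}
    (hP : shearSnd P F ∈ weightLE k 2 1 (degreeOf 1 F)) :
    (P.comp (Polynomial.X + Polynomial.C t) - P).natDegree = 0 := by
  classical
  have hdeg := degreeOf_one_shearSnd P F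
  set L := degreeOf 1 F
  set G := shearSnd P F with hG
  set D := P.comp (Polynomial.X + Polynomial.C t) - P with hD
  -- By flatness, x₂ᴸ is the only monomial of `G` of degree L in x₂.
  obtain ⟨d₀, hd₀, hd₀'⟩ := exists_mem_support_degreeOf (F := G) (i := 1) (by rwa [hdeg])
  rw [hdeg] at hd₀'
  have hd₀0 : d₀ 0 = 0 := by
    have := hP d₀ hd₀
    simp only [wt, hd₀'] at this
    omega
  by_contra hr
  -- Invariance of F at the point (x, P(x)), written in terms of `G`: both G(x + t, -D) and G(x, 0)
  -- equal F(x, P(x)). If r = deg D were positive, the term of x₂ᴸ would have degree rL on the left,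
  -- and everything else would have smaller degree.
  have heq : aeval ![Polynomial.X + Polynomial.C t, -D] G = aeval ![Polynomial.X, 0] G := by
    let ev : MvPolynomial (Fin 2) k →ₐ[k] Polynomial k := aeval ![Polynomial.X, P]
    have e1 : aeval ![Polynomial.X, 0] G = ev F := by
      rw [← shearSnd_shearSnd_neg P F, ← hG, shearSnd_apply, ← AlgHom.comp_apply]
      congr 1
      refine algHom_ext fun j => ?_
      fin_cases j
      · simp [ev]
      · simp [ev, ← Polynomial.aeval_algHom_apply]
    have e2 : aeval ![Polynomial.X + Polynomial.C t, -D] G = ev (translation t F) := by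
      rw [← shearSnd_shearSnd_neg P F, ← hG, shearSnd_apply, translation_apply,
        ← AlgHom.comp_apply, ← AlgHom.comp_apply]
      congr 1
      refine algHom_ext fun j => ?_
      fin_cases j
      · simp [ev, Polynomial.algebraMap_eq]
      · simp [ev, ← Polynomial.aeval_algHom_apply, Polynomial.algebraMap_eq, hD,
          ← Polynomial.comp_eq_aeval]
        ring
    rw [e1, e2, hF]
  set r := D.natDegree
  have hrpos : 0 < r := Nat.pos_of_ne_zero hr
  have hLpos : 0 < L := Nat.pos_of_ne_zero h1
  have hrhs : aeval ![Polynomial.X, 0] G ∈ univLE k (r * L - 1) := by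
    refine aeval_mem_univLE (u := (1 : ℕ)) (v := 0)
      (natDegree_mem_univLE Polynomial.natDegree_X_le) (Submodule.zero_mem _) fun d hd => ?_
    have := hP d hd
    simp only [wt, Nat.cast_one] at this ⊢
    have h2 : (d 0 : ℤ) ≤ L - 1 := by
      have := Nat.cast_nonneg (α := ℤ) (d 1)
      omega
    have h3 : (L : ℤ) ≤ r * L := by exact_mod_cast Nat.le_mul_of_pos_left L hrpos
    linarith
  have hlow : aeval ![Polynomial.X + Polynomial.C t, -D] (G - monomial d₀ (G.coeff d₀)) ∈
      univLE k (r * L - 1) := by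
    refine aeval_mem_univLE (u := (1 : ℕ)) (v := r)
      (natDegree_mem_univLE (Polynomial.natDegree_X_add_C t).le)
      (natDegree_mem_univLE (Polynomial.natDegree_neg D).le) fun d hd => ?_
    rw [mem_support_iff, coeff_sub, coeff_monomial] at hd
    split_ifs at hd with hdd
    · subst hdd; simp at hd
    · rw [sub_zero] at hd
      have h2 := hP d (mem_support_iff.2 hd)
      simp only [wt, Nat.cast_one] at h2 ⊢
      have h0 := Nat.cast_nonneg (α := ℤ) (d 0)
      have hr1 : (1 : ℤ) ≤ r := by exact_mod_cast hrpos
      rcases Nat.eq_zero_or_pos (d 0) with hz | hz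
      · have hne : d 1 ≠ L := fun h => hdd (finsupp_ext (by omega) (by omega))
        have h3 : (d 1 : ℤ) + 1 ≤ L := by omega
        rw [hz]
        push_cast
        nlinarith
      · have h3 : (1 : ℤ) ≤ d 0 := by exact_mod_cast hz
        nlinarith
  have htop : aeval ![Polynomial.X + Polynomial.C t, -D] (monomial d₀ (G.coeff d₀)) ∈
      univLE k (r * L - 1) := by
    have := Submodule.sub_mem _ (heq ▸ hrhs) hlow
    rwa [map_sub, sub_sub_cancel] at this
  rw [aeval_monomial, Finsupp.prod_fintype _ _ (by simp), Fin.prod_univ_two, hd₀0, hd₀'] at htop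
  have hDdeg : ((-D) ^ L).natDegree = r * L := by
    rw [Polynomial.natDegree_pow, Polynomial.natDegree_neg, mul_comm]
  have hD0 : (-D) ^ L ≠ 0 := fun h => by
    rw [h, Polynomial.natDegree_zero] at hDdeg
    have : 0 < r * L := by positivity
    omega
  have := htop (r * L) (by
    have hlc : ((-D) ^ L).coeff (r * L) ≠ 0 := by
      rw [← hDdeg]; exact Polynomial.leadingCoeff_ne_zero.2 hD0
    simpa [Polynomial.algebraMap_eq] using ⟨mem_support_iff.1 hd₀, hlc⟩)
  push_cast at this
  omega

/-- A translation-invariant coordinate with `deg_{x₁} ≥ 2 deg_{x₂} > 0` can be reduced by a shear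
commuting with the translation. -/
theorem exists_shearSnd_degreeOf_le (p : ℕ) [Fact p.Prime] [CharP k p] {t : k} (ht : t ≠ 0)
    (φ : Aut2 k) (i : Fin 2) (hF : translation t (φ (X i)) = φ (X i))
    (h1 : degreeOf 1 (φ (X i)) ≠ 0) :
    ∃ Q : Polynomial k, Polynomial.X ∣ Q ∧
      degreeOf 0 (shearSnd (Q.comp (Polynomial.X ^ p - Polynomial.C (t ^ (p - 1)) * Polynomial.X))
        (φ (X i))) ≤ degreeOf 1 (φ (X i)) := by
  obtain ⟨P, hP⟩ := exists_shearSnd_mem_weightLE p φ i h1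
  have hconst := natDegree_comp_X_add_C_sub_eq_zero hF h1 hP
  set F := φ (X i)
  set L := degreeOf 1 F
  set Y : Polynomial k := Polynomial.X ^ p - Polynomial.C (t ^ (p - 1)) * Polynomial.X
  rw [Polynomial.natDegree_eq_zero] at hconst
  obtain ⟨δ, hδ⟩ := hconst
  -- With δ the constant P(x + t) - P(x), subtracting (δ/t)x makes `P` invariant.
  obtain ⟨Q, hQ⟩ := exists_eq_comp_of_comp_X_add_C p ht
    (P - Polynomial.C (δ / t) * Polynomial.X) (by
      have h2 : Polynomial.C (δ / t) * Polynomial.C t = Polynomial.C δ := by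
        rw [← Polynomial.C_mul, div_mul_cancel₀ _ ht]
      simp only [Polynomial.sub_comp, Polynomial.mul_comp, Polynomial.C_comp, Polynomial.X_comp]
      linear_combination -hδ - h2)
  change _ = Q.comp Y at hQ
  refine ⟨Q - Polynomial.C (Q.coeff 0), ?_, ?_⟩
  · rw [Polynomial.X_dvd_iff]; simp
  · have h2 : shearSnd ((Q - Polynomial.C (Q.coeff 0)).comp Y) F =
        shearSnd (-(Polynomial.C (δ / t) * Polynomial.X + Polynomial.C (Q.coeff 0)))
          (shearSnd P F) := by
      rw [← AlgEquiv.mul_apply (shearSnd _) (shearSnd _) F, shearSnd_mul_shearSnd]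
      congr 2
      rw [Polynomial.sub_comp, Polynomial.C_comp, ← hQ]
      ring
    rw [h2, degreeOf_zero_le, shearSnd_apply]
    refine aeval_mem_weightLE (u' := 1) (v' := 1) X_zero_mem_weightLE (Submodule.add_mem _
      (weightLE_mono zero_le_one X_one_mem_weightLE) (weightLE_mono ?_
        (aeval_X_zero_mem_weightLE _))) fun d hd => ?_
    · rw [Polynomial.natDegree_neg]
      exact_mod_cast Polynomial.natDegree_linear_le
    · have := hP d hd
      simp only [wt] at this ⊢
      have := Nat.cast_nonneg (α := ℤ) (d 0)
      linarith

/-- A coordinate with top form `c (x₁ - α x₂ᵇ)ᴸ` can be reduced by a shear. -/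
theorem HasBinomialTop.degreeOf_shearFst {F : MvPolynomial (Fin 2) k} {b L : ℕ} {c α : k}
    (h : HasBinomialTop F 1 b L c α) :
    degreeOf 0 (shearFst (Polynomial.C α * Polynomial.X ^ b) F) ≤ degreeOf 0 F ∧
      degreeOf 1 (shearFst (Polynomial.C α * Polynomial.X ^ b) F) < degreeOf 1 F := by
  have hb := Nat.pos_of_ne_zero h.b_ne
  have hL := Nat.pos_of_ne_zero h.L_ne
  have hbL : 0 < b * L := by positivity
  set g : Polynomial k := Polynomial.C α * Polynomial.X ^ b
  have hg : Polynomial.aeval (X 1 : MvPolynomial (Fin 2) k) g = C α * X 1 ^ b := by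
    simp [g, algebraMap_eq]
  have m1 : shearFst g (F - C c * (X 0 ^ 1 - C α * X 1 ^ b) ^ L) ∈
      weightLE k b 1 ((b * L : ℤ) - 1) := by
    rw [shearFst_apply, hg]
    refine aeval_mem_weightLE (u' := b) (v' := 1) (Submodule.add_mem _ X_zero_mem_weightLE
      (C_mul_mem_weightLE _ ?_)) X_one_mem_weightLE (by simpa using h.mem)
    simpa using pow_mem_weightLE (X_one_mem_weightLE (k := k) (u := b) (v := 1)) b
  have m2 : shearFst g (C c * (X 0 ^ 1 - C α * X 1 ^ b) ^ L) = C c * X 0 ^ L := by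
    rw [shearFst_apply, hg]
    simp [algebraMap_eq]
  rw [map_sub, m2] at m1
  rw [h.degreeOf_zero, h.degreeOf_one, one_mul]
  constructor
  · have m3 : shearFst g F - C c * X 0 ^ L ∈ weightLE k 1 0 L := by
      intro d hd
      have h2 := m1 d hd
      simp only [wt] at h2 ⊢
      have h3 : (b : ℤ) * d 0 ≤ b * L := by
        have := Nat.cast_nonneg (α := ℤ) (d 1)
        linarith
      have := le_of_mul_le_mul_left h3 (by exact_mod_cast hb)
      linarith
    have m4 : C c * X 0 ^ L ∈ weightLE k 1 0 L :=
      C_mul_mem_weightLE _ (by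
        simpa using pow_mem_weightLE (X_zero_mem_weightLE (k := k) (u := 1) (v := 0)) L)
    rw [degreeOf_zero_le]
    simpa using Submodule.add_mem _ m3 m4
  · have m3 : shearFst g F - C c * X 0 ^ L ∈ weightLE k 0 1 ((b * L : ℤ) - 1) := by
      intro d hd
      have h2 := m1 d hd
      simp only [wt] at h2 ⊢
      have : 0 ≤ (b : ℤ) * d 0 := by positivity
      linarith
    have m4 : C c * X 0 ^ L ∈ weightLE k 0 1 ((b * L : ℤ) - 1) := by
      refine C_mul_mem_weightLE _ (weightLE_mono ?_ (pow_mem_weightLE X_zero_mem_weightLE L))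
      have : (0 : ℤ) < b * L := by exact_mod_cast hbL
      omega
    have m5 : shearFst g F ∈ weightLE k 0 1 ((b * L : ℤ) - 1) := by
      simpa using Submodule.add_mem _ m3 m4
    have : degreeOf 1 (shearFst g F) ≤ b * L - 1 := by
      rw [degreeOf_one_le]
      refine weightLE_mono (by omega) m5
    omega

/-- The end of the descent: φ(x₂) is affine in x₂, so φ(x₁) = c x₁ + g(x₂). Commuting with the
translation gives ct = t, hence c = 1; the constant term of g goes into H₀. -/
theorem mem_H_mul_of_degreeOf_zero_eq_zero (p : ℕ) [Fact p.Prime] [CharP k p] {t : k}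
    (ht : t ≠ 0) {φ : Aut2 k} (hφ : φ ∈ Subgroup.centralizer {translation t})
    (h0 : degreeOf 0 (φ (X 1)) = 0) : φ ∈ (H p t : Set (Aut2 k)) * H₀ k := by
  obtain ⟨g, hg⟩ := exists_eq_aeval_X_one (degreeOf_zero_le.1 h0.le)
  obtain ⟨b, e, hb, hφ1⟩ := exists_eq_C_mul_X_add_C φ 1 1 g hg
  obtain ⟨c, g', hφ0⟩ := exists_eq_C_mul_X_zero_add p φ hb hφ1
  have hc : (c - 1) * t = 0 := by
    have h2 := mem_centralizer_translation.1 hφ (X 0)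
    rw [hφ0] at h2
    simp only [translation_apply, map_add, map_mul, aeval_X, aeval_C, algebraMap_eq,
      Matrix.cons_val_zero, hφ0, ← Polynomial.aeval_algHom_apply, Matrix.cons_val_one] at h2
    have h3 : (C ((c - 1) * t) : MvPolynomial (Fin 2) k) = 0 := by
      have h4 : φ (C t) = C t := φ.commutes t
      rw [h4] at h2
      rw [C_mul, C_sub, C_1]
      linear_combination h2
    rwa [C_eq_zero] at h3
  have hgX : Polynomial.X ∣ g' - Polynomial.C (g'.coeff 0) := by
    rw [Polynomial.X_dvd_iff]; simp
  have hc1 : c = 1 := by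
    have := (mul_eq_zero.1 hc).resolve_right ht
    exact sub_eq_zero.1 this
  refine ⟨shearFst (g' - Polynomial.C (g'.coeff 0)), Subgroup.subset_closure (Or.inl ⟨_, hgX, rfl⟩),
    diagAff (Units.mk0 b hb) (g'.coeff 0) e, ⟨_, _, _, rfl⟩, ?_⟩
  refine aut_ext ?_ ?_
  · simp only [AlgEquiv.mul_apply, diagAff_apply, shearFst_apply, hφ0, hc1]
    simp [algebraMap_eq, add_assoc]
  · simp only [AlgEquiv.mul_apply, diagAff_apply, shearFst_apply, hφ1]
    simp [algebraMap_eq]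

theorem mem_H_mul_of_mem_centralizer (p : ℕ) [Fact p.Prime] [CharP k p] {t : k} (ht : t ≠ 0)
    (φ : Aut2 k) (hφ : φ ∈ Subgroup.centralizer {translation t}) :
    φ ∈ (H p t : Set (Aut2 k)) * H₀ k := by
  induction hn : degreeOf 0 (φ (X 1)) + degreeOf 1 (φ (X 1)) using Nat.strong_induction_on
    generalizing φ with
  | _ n ih =>
  subst hn
  have hstep : ∀ τ ∈ H p t, degreeOf 0 (τ (φ (X 1))) + degreeOf 1 (τ (φ (X 1))) <
      degreeOf 0 (φ (X 1)) + degreeOf 1 (φ (X 1)) → φ ∈ (H p t : Set (Aut2 k)) * H₀ k := by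
    intro τ hτ hlt
    obtain ⟨η, hη, δ, hδ, h⟩ := ih _ hlt (τ * φ) (mul_mem (H_le_centralizer p t hτ) hφ) rfl
    refine ⟨τ⁻¹ * η, mul_mem (inv_mem hτ) hη, δ, hδ, ?_⟩
    change η * δ = τ * φ at h
    change τ⁻¹ * η * δ = φ
    rw [mul_assoc, h, inv_mul_cancel_left]
  have hinv : translation t (φ (X 1)) = φ (X 1) := by
    rw [mem_centralizer_translation.1 hφ]
    simp [translation_apply]
  by_cases h0 : degreeOf 0 (φ (X 1)) = 0
  · exact mem_H_mul_of_degreeOf_zero_eq_zero p ht hφ h0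
  by_cases h1 : degreeOf 1 (φ (X 1)) = 0
  -- Here φ(x₂) = b x₁ + e with b ≠ 0, which the translation moves by bt ≠ 0.
  · exfalso
    obtain ⟨g, hg⟩ := exists_eq_aeval_X_zero (degreeOf_one_le.1 h1.le)
    obtain ⟨b, e, hb, hφ1⟩ := exists_eq_C_mul_X_add_C φ 1 0 g hg
    rw [hφ1] at hinv
    simp only [translation_apply, map_add, map_mul, aeval_X, aeval_C, algebraMap_eq,
      Matrix.cons_val_zero] at hinv
    have h2 : (C (b * t) : MvPolynomial (Fin 2) k) = 0 := by
      rw [C_mul]; linear_combination hinv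
    simp [hb, ht] at h2
  obtain ⟨a, b, L, c, α, htop, hab⟩ := exists_hasBinomialTop p φ 1 h0 h1
  by_cases ha : a = 1
  · subst ha
    obtain ⟨h2, h3⟩ := htop.degreeOf_shearFst
    refine hstep _ (Subgroup.subset_closure (Or.inl
      ⟨Polynomial.C α * Polynomial.X ^ b, ?_, rfl⟩)) (by omega)
    exact (dvd_pow_self Polynomial.X htop.b_ne).mul_left _
  -- Now deg_{x₁} = aL ≥ 2L and deg_{x₂} = L. The shear keeps deg_{x₂} and brings deg_{x₁} down to
  -- at most L, so the sum drops.
  · have hb1 := hab.resolve_left ha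
    subst hb1
    obtain ⟨Q, hQX, hQ⟩ := exists_shearSnd_degreeOf_le p ht φ 1 hinv h1
    refine hstep _ (Subgroup.subset_closure (Or.inr ⟨Q, hQX, rfl⟩)) ?_
    rw [degreeOf_one_shearSnd]
    have h2 := htop.degreeOf_zero
    have h3 := htop.degreeOf_one
    have h4 := htop.L_ne
    have h5 := htop.a_ne
    have h6 : 2 * L ≤ a * L := Nat.mul_le_mul_right L (by omega)
    omega

end Centralizer

end PlaneAut

theorem theorem5p1 {k : Type*} [Field k] (p : ℕ) [Fact p.Prime] [CharP k p] (t : k) (ht : t ≠ 0) :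
    (Subgroup.centralizer {PlaneAut.translation t} : Set (PlaneAut.Aut2 k)) =
      (PlaneAut.H p t : Set (PlaneAut.Aut2 k)) * PlaneAut.H₀ k := by
  refine Set.Subset.antisymm (fun φ hφ => PlaneAut.mem_H_mul_of_mem_centralizer p ht φ hφ) ?_
  rintro _ ⟨η, hη, _, ⟨a, u₁, u₂, rfl⟩, rfl⟩
  exact mul_mem (PlaneAut.H_le_centralizer p t hη) (PlaneAut.diagAff_mem_centralizer t a u₁ u₂)
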